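/- **Setting.** Let $N\ge 1$. The first of $N$ qubits carries a one-qubit quantum secret $S$ that is maximally entangled with a reference qubit $R$; the other $N-1$ qubits (the players' ancillas) are in an arbitrary pure state $|\phi\rangle$. A unitary $U\in \mathrm U(2^N)$ is applied to the $N$ qubits, so that the joint state of $R$ and the $N$ qubits becomes $$|\Psi_U\rangle=(1_R\otimes U)\,\tfrac{1}{\sqrt2}\big(|0\rangle_R|0\rangle_S+|1\rangle_R|1\rangle_S\big)\otimes|\phi\rangle .$$ For a set $P$ of qubits (a region, of size $|P|$), $I(R:P)=S(R)+S(P)-S(RP)$ is the quantum mutual information in $|\Psi_U\rangle$, with von Neumann entropies of the reduced density matrices in base $2$; $I(R:S)$ is the mutual information of $R$ and the secret qubit before $U$ is applied. For real $b,g$ with $1\le b<g\le N$ and $\eta>0$, the encoding by $U$ is an *$((b,g))$ ramp secret-sharing scheme up to $\eta$* if $I(R:P)\le\eta$ for every region with $|P|\le b$ (approximate secrecy) and $I(R:P)\ge I(R:S)-\eta$ for every region with $|P|\ge g$ (approximate recoverability). **Theorem.** There is an absolute constant $C>0$ such that for every real $\varepsilon>0$, with $\gamma=4^{-\varepsilon}$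 (equivalently $\varepsilon=\log_2\sqrt{1/\gamma}$), the following hold for $U$ drawn from the Haar probability measure on $\mathrm U(2^N)$. 1. For every $N\ge1$, every unit vector $|\phi\rangle$ and every region $P$, the function $U\mapsto I(R:P)$ is integrable, and $$\mathbb E_U\, I(R:P)\le C\gamma\ \text{ if } |P|\le \tfrac N2-\varepsilon,\qquad \mathbb E_U\, I(R:P)\ge I(R:S)-C\gamma\ \text{ if } |P|\ge \tfrac N2+\varepsilon .$$ 2. The probability that the encoding by $U$ is an $\left(\left(\tfrac N2-\varepsilon,\tfrac N2+\varepsilon\right)\right)$ ramp secret-sharing scheme up to $C\gamma$ (that is, for all regions simultaneously) tends to $1$ as $N\to\infty$ with $\varepsilon$ fixed, uniformly in $|\phi\rangle$. -/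

import Mathlib

open MeasureTheory

noncomputable section

namespace RampSecret

/-! ## Qubits, reduced states, entropy -/

/-- Computational basis labels of a collection of qubits with sites `ι`. -/
abbrev Bits (ι : Type) : Type := ι → Fin 2

/-- The basis label that reads `x` on the sites in `A` and `z` on the remaining sites. -/
def glue {ι : Type} [DecidableEq ι] (A : Finset ι)
    (x : Bits {i // i ∈ A}) (z : Bits {i // i ∉ A}) : Bits ι :=
  fun i => if h : i ∈ A then x ⟨i, h⟩ else z ⟨i, h⟩

/-- The reduced density matrix on the sites `A` of the pure state of the qubits `ι` with amplitude
vector `ψ`, i.e. the partial trace of `|ψ⟩⟨ψ|` over the sites outside `A`. -/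
def reducedDensity {ι : Type} [Fintype ι] [DecidableEq ι]
    (ψ : Bits ι → ℂ) (A : Finset ι) :
    Matrix (Bits {i // i ∈ A}) (Bits {i // i ∈ A}) ℂ :=
  Matrix.of fun x y => ∑ z : Bits {i // i ∉ A}, ψ (glue A x z) * star (ψ (glue A y z))

theorem reducedDensity_isHermitian {ι : Type} [Fintype ι] [DecidableEq ι]
    (ψ : Bits ι → ℂ) (A : Finset ι) : (reducedDensity ψ A).IsHermitian := by
  ext x y
  simp [reducedDensity, Matrix.conjTranspose_apply, mul_comm]

/-- The von Neumann entropy `-∑ λ log₂ λ` (in bits) of a Hermitian matrix with eigenvalues `λ`. -/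
def vonNeumannEntropy {m : Type} [Fintype m] [DecidableEq m]
    (ρ : Matrix m m ℂ) (hρ : ρ.IsHermitian) : ℝ :=
  (∑ i, Real.negMulLog (hρ.eigenvalues i)) / Real.log 2

/-- The entropy `S(A)` of the sites `A` in the pure state `ψ`. -/
def entropy {ι : Type} [Fintype ι] [DecidableEq ι] (ψ : Bits ι → ℂ) (A : Finset ι) : ℝ :=
  vonNeumannEntropy (reducedDensity ψ A) (reducedDensity_isHermitian ψ A)

/-- The mutual information `I(A:B) = S(A) + S(B) - S(AB)` of disjoint sets of sites `A`, `B` in the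
pure state `ψ`. -/
def mutualInfo {ι : Type} [Fintype ι] [DecidableEq ι]
    (ψ : Bits ι → ℂ) (A B : Finset ι) : ℝ :=
  entropy ψ A + entropy ψ B - entropy ψ (A ∪ B)

/-! ## The encoding

There are `N = n + 1` qubits, labelled by `Fin (n + 1)`.  Before the encoding qubit `0` carries the
secret and the other `n` qubits (the players) are in a pure state `φ`.  The total system has one
more qubit, the reference `R`, which is the site `none` of `Option (Fin (n + 1))`; qubit `i` is the
site `some i`. -/

/-- Amplitudes of the initial state `2^{-1/2} (|0⟩_R |0⟩ + |1⟩_R |1⟩) ⊗ |φ⟩`. -/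
def initialState {n : ℕ} (φ : EuclideanSpace ℂ (Bits (Fin n))) :
    Bits (Option (Fin (n + 1))) → ℂ :=
  fun x => if x none = x (some 0) then ((1 / √2 : ℝ) : ℂ) * φ (fun i => x (some i.succ)) else 0

/-- Amplitudes of the state `(1_R ⊗ U) |Ψ⟩`, where `U` acts on the `N` qubits other than `R`. -/
def evolve {N : ℕ} (U : Matrix (Bits (Fin N)) (Bits (Fin N)) ℂ)
    (Ψ : Bits (Option (Fin N)) → ℂ) : Bits (Option (Fin N)) → ℂ :=
  fun x => ∑ y : Bits (Fin N),
    U (fun i => x (some i)) y * Ψ (fun o => o.elim (x none) y)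

/-- The state of the reference and the `N = n + 1` qubits after the encoding by `U`. -/
def encodedState {n : ℕ} (φ : EuclideanSpace ℂ (Bits (Fin n)))
    (U : Matrix.unitaryGroup (Bits (Fin (n + 1))) ℂ) : Bits (Option (Fin (n + 1))) → ℂ :=
  evolve (U : Matrix (Bits (Fin (n + 1))) (Bits (Fin (n + 1))) ℂ) (initialState φ)

/-- `I(R:S)`: the mutual information of the reference and the secret qubit before the encoding. -/
def secretInfo {n : ℕ} (φ : EuclideanSpace ℂ (Bits (Fin n))) : ℝ :=
  mutualInfo (initialState φ) {none} {some 0}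

/-- `I(R:P)`: the mutual information of the reference and the region `P` after the encoding. -/
def regionInfo {n : ℕ} (φ : EuclideanSpace ℂ (Bits (Fin n)))
    (U : Matrix.unitaryGroup (Bits (Fin (n + 1))) ℂ) (P : Finset (Fin (n + 1))) : ℝ :=
  mutualInfo (encodedState φ U) {none} (P.map Function.Embedding.some)

/-- The encoding by `U` with the players in the state `φ` is a `((b, g))` ramp secret-sharing scheme
for `N = n + 1` parties up to an error `η`: every set of at most `b` parties has at most `η` of
information on the secret, and every set of at least `g` parties has all of it up to `η`. -/
structure IsApproxRampScheme {n : ℕ} (φ : EuclideanSpace ℂ (Bits (Fin n)))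
    (U : Matrix.unitaryGroup (Bits (Fin (n + 1))) ℂ) (b g η : ℝ) : Prop where
  one_le : 1 ≤ b
  lt : b < g
  le_card : g ≤ (n : ℝ) + 1
  secrecy : ∀ P : Finset (Fin (n + 1)), (P.card : ℝ) ≤ b → regionInfo φ U P ≤ η
  recoverability : ∀ P : Finset (Fin (n + 1)), g ≤ (P.card : ℝ) →
    secretInfo φ - η ≤ regionInfo φ U P

/-! ## Haar measure on the unitary group -/

instance instMeasurableSpaceUnitary (m : Type) [Fintype m] [DecidableEq m] :
    MeasurableSpace (Matrix.unitaryGroup m ℂ) := borel _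

instance instBorelSpaceUnitary (m : Type) [Fintype m] [DecidableEq m] :
    BorelSpace (Matrix.unitaryGroup m ℂ) := ⟨rfl⟩

instance instCompactSpaceUnitary (m : Type) [Fintype m] [DecidableEq m] :
    CompactSpace (Matrix.unitaryGroup m ℂ) := by
  refine isCompact_iff_compactSpace.mp ?_
  have hK : IsCompact (Set.pi Set.univ fun _ : m => Set.pi Set.univ fun _ : m =>
      Metric.closedBall (0 : ℂ) 1) :=
    isCompact_univ_pi fun _ => isCompact_univ_pi fun _ => isCompact_closedBall 0 1
  refine hK.of_isClosed_subset ?_ ?_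
  · have h : ((Matrix.unitaryGroup m ℂ : Submonoid (Matrix m m ℂ)) : Set (Matrix m m ℂ)) =
        {A | A * star A = 1} := by
      ext A
      exact Matrix.mem_unitaryGroup_iff
    rw [h]
    have hc : Continuous fun A : Matrix m m ℂ => A * star A := by fun_prop
    exact isClosed_eq hc continuous_const
  · intro A hA i _ j _
    simpa using entry_norm_bound_of_unitary hA i j

/-- The Haar probability measure on the group of unitary matrices with index type `m`. -/
def haarUnitary (m : Type) [Fintype m] [DecidableEq m] : Measure (Matrix.unitaryGroup m ℂ) :=
  Measure.haarMeasure ⊤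

end RampSecret

end

/-!
Everything is reduced to the purity of a single uniformly random pure state.

*From information to purity.*  The state `Ψ` of the reference `R` and the `N` qubits is pure, so
`S(RP) = S(Pᶜ)` (`entropy_compl`) and `I(R:P) + I(R:Pᶜ) = 2 S(R) = 2`.  Recoverability from `P` is
thus secrecy of `Pᶜ`.  For secrecy, `S(R) ≤ 1` and `S(P) ≤ |P|`, while `log x ≤ x - 1` bounds
`S(RP) = S(Pᶜ)` from below by an affine function of the purity of `Pᶜ`; no logarithm of a random
variable remains.

*From two branches to one random state.*  With the reference in `0` or `1`, the `N` qubits are in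
one of two orthonormal vectors `u₀`, `u₁`, which are not independent.  But the purities of `P` and
of `Pᶜ` in `Ψ` add up to `3 / 2` times the mean purity on `P` of the six states `u₀`, `u₁`,
`(u₀ + w u₁) / √2` with `w⁴ = 1` (`trace_sq_add_trace_sq`), because these six states form a complex
projective two-design.  The purity of `P` in `Ψ` is at least `2 ^ (-|P|)`, so
`I(R:P) ≤ (3 / log 2) (2 ^ |P| Q - 1)` with `Q` the mean purity over the six states
(`mutualInfo_le`), and each of the six is the image of a fixed unit vector under the Haar-random
unitary.

*Moments.*  Differentiating the unitary invariance of a random unit vector gives an integration by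
parts formula on the sphere (`moment_divergence`).  Write the vector as a matrix `G` of size
`a × b`.  The formula for the vector field `G G* G` gives the mean purity `(a + b) / (a b + 1)`, and
the formulas for `Tr ((G G*)²) G G* G` and `G G* G G* G` bound its variance by `2 / (a b)²`
(`integral_purity_sub_sq_le`).  The first moment yields the averaged statement.

*All regions.*  By Chebyshev's inequality a region of `p ≤ N / 2 - ε` qubits violates secrecy with
probability `O(4 ^ p / 4 ^ N)` for fixed `ε`.  The sum over all such regions is at most of order
`2 ^ (-N)` times the central binomial coefficient, that is `O(1 / √N)` (`sum_four_pow_div_le`).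
-/

noncomputable section

namespace RampSecret

open Matrix
open scoped ComplexOrder

set_option linter.unusedSectionVars false

/-! ### Integration by parts on the complex sphere -/

section Stein

open MvPolynomial

variable {κ : Type} [Fintype κ] [DecidableEq κ]

open scoped Matrix.Norms.L2Operator in
/-- The one-parameter group `exp (t A)`, described entrywise so that no choice of a matrix norm is
needed to use it. -/
theorem exists_unitary_flow (A : Matrix κ κ ℂ) (hA : Aᴴ = -A) :
    ∃ W : ℝ → Matrix κ κ ℂ, W 0 = 1 ∧ (∀ t, W t ∈ unitaryGroup κ ℂ) ∧
      ∀ t i j, HasDerivAt (fun s => W s i j) ((A * W t) i j) t := by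
  let _ : NormedAlgebra ℚ (Matrix κ κ ℂ) := NormedAlgebra.restrictScalars ℚ ℂ _
  refine ⟨fun t => NormedSpace.exp (t • A), by simp, fun t => ?_, fun t i j => ?_⟩
  · have h : t • A ∈ skewAdjoint (Matrix κ κ ℂ) := by
      rw [skewAdjoint.mem_iff, Matrix.star_eq_conjTranspose, conjTranspose_smul, hA]
      simp
    exact NormedSpace.exp_mem_unitary_of_mem_skewAdjoint h
  · have h := hasDerivAt_exp_smul_const' (𝕂 := ℝ) A t
    let l : Matrix κ κ ℂ →L[ℝ] ℂ := LinearMap.toContinuousLinearMap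
      { toFun := fun M => M i j, map_add' := fun _ _ => rfl, map_smul' := fun _ _ => rfl }
    exact l.hasFDerivAt.comp_hasDerivAt t h

/-- Evaluation at the vector `u` and its complex conjugate: the variable `inl i` stands for `u i`
and `inr i` for the conjugate of `u i`, so that polynomials in both have formal Wirtinger
derivatives `pderiv`. -/
def conjEval (u : κ → ℂ) : MvPolynomial (κ ⊕ κ) ℂ →ₐ[ℂ] ℂ :=
  aeval (Sum.elim u fun i => star (u i))

@[simp] theorem conjEval_inl (u : κ → ℂ) (i : κ) : conjEval u (X (.inl i)) = u i := by
  simp [conjEval]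

@[simp] theorem conjEval_inr (u : κ → ℂ) (i : κ) : conjEval u (X (.inr i)) = star (u i) := by
  simp [conjEval]

theorem continuous_conjEval (p : MvPolynomial (κ ⊕ κ) ℂ) : Continuous fun u => conjEval u p := by
  induction p using MvPolynomial.induction_on with
  | C a => simpa [conjEval] using continuous_const
  | add p q hp hq => simpa using hp.fun_add hq
  | mul_X p i hp =>
    rcases i with i | i
    · simpa using hp.fun_mul (continuous_apply i)
    · simpa using hp.fun_mul (continuous_apply i).star

/-- The infinitesimal action of the matrix `A` on polynomials in a vector and its conjugate: the
variable `u i` goes to `(A u) i` and its conjugate to minus the `i`-th entry of `Aᵀ ū`.  For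
skew-Hermitian `A` this is the derivative along the flow `exp (t A)`; the sign and the transpose
make it complex linear in `A`. -/
def rotation (A : Matrix κ κ ℂ) :
    Derivation ℂ (MvPolynomial (κ ⊕ κ) ℂ) (MvPolynomial (κ ⊕ κ) ℂ) :=
  mkDerivation ℂ (Sum.elim (fun i => ∑ j, C (A i j) * X (.inl j))
    fun i => -∑ j, C (A j i) * X (.inr j))

theorem rotation_inl (A : Matrix κ κ ℂ) (i : κ) :
    rotation A (X (.inl i)) = ∑ j, C (A i j) * X (.inl j) := by simp [rotation]

theorem rotation_inr (A : Matrix κ κ ℂ) (i : κ) :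
    rotation A (X (.inr i)) = -∑ j, C (A j i) * X (.inr j) := by simp [rotation]

theorem rotation_add (A B : Matrix κ κ ℂ) : rotation (A + B) = rotation A + rotation B := by
  refine derivation_ext fun i => ?_
  rcases i with i | i <;>
    simp [rotation_inl, rotation_inr, add_mul, Finset.sum_add_distrib, add_comm]

theorem rotation_smul (c : ℂ) (A : Matrix κ κ ℂ) : rotation (c • A) = c • rotation A := by
  refine derivation_ext fun i => ?_
  rcases i with i | i <;>
    simp [rotation_inl, rotation_inr, mul_assoc, Finset.smul_sum, MvPolynomial.smul_eq_C_mul]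

theorem rotation_single (i j : κ) (p : MvPolynomial (κ ⊕ κ) ℂ) :
    rotation (Matrix.single i j 1) p =
      X (.inl j) * pderiv (.inl i) p - X (.inr i) * pderiv (.inr j) p := by
  have h : rotation (Matrix.single i j 1) =
      (X (.inl j) : MvPolynomial (κ ⊕ κ) ℂ) • pderiv (.inl i) -
        (X (.inr i) : MvPolynomial (κ ⊕ κ) ℂ) • pderiv (R := ℂ) (.inr j) := by
    refine derivation_ext fun k => ?_
    rcases k with k | k
    · by_cases hk : i = k
      · subst hk; simp [rotation_inl, Matrix.single, pderiv_X]
      · simp [rotation_inl, Matrix.single, pderiv_X, hk, Ne.symm hk]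
    · by_cases hk : j = k
      · subst hk; simp [rotation_inr, Matrix.single, pderiv_X]
      · simp [rotation_inr, Matrix.single, pderiv_X, hk, Ne.symm hk]
  rw [h]; rfl

/-- The derivation that multiplies a polynomial by its degree in the conjugate variables. -/
def conjDegree :
    Derivation ℂ (MvPolynomial (κ ⊕ κ) ℂ) (MvPolynomial (κ ⊕ κ) ℂ) :=
  mkDerivation ℂ (Sum.elim (fun _ => 0) fun i => X (.inr i))

theorem conjDegree_inl (i : κ) :
    conjDegree (X (.inl i) : MvPolynomial (κ ⊕ κ) ℂ) = 0 := by simp [conjDegree]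

theorem conjDegree_inr (i : κ) :
    conjDegree (X (.inr i) : MvPolynomial (κ ⊕ κ) ℂ) = X (.inr i) := by simp [conjDegree]

theorem derivation_sum_apply {R A M ι : Type*} [CommSemiring R] [CommSemiring A]
    [AddCommMonoid M] [Algebra R A] [Module A M] [Module R M] (s : Finset ι)
    (D : ι → Derivation R A M) (a : A) : (∑ i ∈ s, D i) a = ∑ i ∈ s, D i a := by
  classical
  induction s using Finset.induction_on with
  | empty => simp
  | insert i s hi ih => simp [Finset.sum_insert hi, ih]

theorem conjDegree_eq_sum (p : MvPolynomial (κ ⊕ κ) ℂ) :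
    conjDegree p = ∑ j, X (.inr j) * pderiv (.inr j) p := by
  have h : (conjDegree : Derivation ℂ (MvPolynomial (κ ⊕ κ) ℂ) (MvPolynomial (κ ⊕ κ) ℂ)) =
      ∑ j, (X (.inr j) : MvPolynomial (κ ⊕ κ) ℂ) • pderiv (R := ℂ) (.inr j) := by
    refine derivation_ext fun k => ?_
    rcases k with k | k <;>
      simp [conjDegree, pderiv_X, Pi.single_apply, derivation_sum_apply]
  rw [h]; simp [derivation_sum_apply]

theorem hasDerivAt_conjEval (A : Matrix κ κ ℂ) (hA : Aᴴ = -A) (c : ℝ → κ → ℂ) (t : ℝ)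
    (hc : ∀ i, HasDerivAt (fun s => c s i) ((A *ᵥ c t) i) t) (p : MvPolynomial (κ ⊕ κ) ℂ) :
    HasDerivAt (fun s => conjEval (c s) p) (conjEval (c t) (rotation A p)) t := by
  induction p using MvPolynomial.induction_on with
  | C a => simpa [conjEval] using hasDerivAt_const t a
  | add p q hp hq => simpa using hp.fun_add hq
  | mul_X p i hp =>
    have hX : HasDerivAt (fun s => conjEval (c s) (X i))
        (conjEval (c t) (rotation A (X i))) t := by
      rcases i with i | i
      · simpa [rotation_inl, mulVec, dotProduct, conjEval] using hc i
      · have h := (hc i).star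
        have h2 : ∀ j, star (A i j) = -A j i := fun j => by
          have := congrFun (congrFun hA j) i
          simpa using this
        have h3 : star ((A *ᵥ c t) i) = conjEval (c t) (rotation A (X (.inr i))) := by
          simp only [mulVec, dotProduct, star_sum, star_mul', h2]
          simp [rotation_inr, conjEval]
        rw [h3] at h
        simpa using h
    simpa [Derivation.leibniz, mul_comm, add_comm] using hp.fun_mul hX

variable {Ω : Type} [MeasurableSpace Ω]

/-- The random vector `u` is a unit vector whose distribution is invariant under all unitary
matrices.  Invariance is only asked of the expectations of continuous functions. -/
structure IsUniformUnitVector (μ : Measure Ω) (u : Ω → κ → ℂ) : Prop where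
  measurable : Measurable u
  norm_sq : ∀ ω, ∑ i, u ω i * star (u ω i) = 1
  invariant : ∀ W ∈ unitaryGroup κ ℂ, ∀ f : (κ → ℂ) → ℂ, Continuous f →
    ∫ ω, f (W *ᵥ u ω) ∂μ = ∫ ω, f (u ω) ∂μ

theorem norm_sq_mulVec {W : Matrix κ κ ℂ} (hW : W ∈ unitaryGroup κ ℂ) (v : κ → ℂ) :
    ∑ i, (W *ᵥ v) i * star ((W *ᵥ v) i) = ∑ i, v i * star (v i) := by
  change (W *ᵥ v) ⬝ᵥ star (W *ᵥ v) = v ⬝ᵥ star v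
  rw [star_mulVec, dotProduct_comm, ← dotProduct_mulVec, mulVec_mulVec,
    ← star_eq_conjTranspose, mem_unitaryGroup_iff'.1 hW, one_mulVec, dotProduct_comm]

theorem norm_apply_le_one {v : κ → ℂ} (hv : ∑ i, v i * star (v i) = 1) (i : κ) : ‖v i‖ ≤ 1 := by
  have h : ∑ i, ‖v i‖ ^ 2 = 1 := by
    have : ((∑ i, ‖v i‖ ^ 2 : ℝ) : ℂ) = 1 := by
      rw [← hv]; push_cast
      exact Finset.sum_congr rfl fun i _ => (Complex.mul_conj' (v i)).symm
    exact_mod_cast this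
  have h1 := Finset.single_le_sum (f := fun i => ‖v i‖ ^ 2) (fun i _ => sq_nonneg _)
    (Finset.mem_univ i)
  rw [h] at h1
  exact (sq_le_one_iff₀ (norm_nonneg _)).1 h1

theorem exists_bound_of_continuous (f : (κ → ℂ) → ℂ) (hf : Continuous f) :
    ∃ C, ∀ v : κ → ℂ, ∑ i, v i * star (v i) = 1 → ‖f v‖ ≤ C := by
  obtain ⟨C, hC⟩ := (isCompact_closedBall (0 : κ → ℂ) 1).exists_bound_of_continuousOn
    hf.continuousOn
  refine ⟨C, fun v hv => hC v ?_⟩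
  rw [mem_closedBall_zero_iff, pi_norm_le_iff_of_nonneg zero_le_one]
  exact norm_apply_le_one hv

variable {μ : Measure Ω} {u : Ω → κ → ℂ}

/-- The expectation of a polynomial in the entries of a random vector and their conjugates. -/
def moment (μ : Measure Ω) (u : Ω → κ → ℂ) (p : MvPolynomial (κ ⊕ κ) ℂ) : ℂ :=
  ∫ ω, conjEval (u ω) p ∂μ

theorem moment_smul (c : ℂ) (p : MvPolynomial (κ ⊕ κ) ℂ) :
    moment μ u (c • p) = c * moment μ u p := by
  simp only [moment, map_smul, smul_eq_mul, integral_const_mul]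

theorem moment_one [IsProbabilityMeasure μ] : moment μ u 1 = 1 := by
  simp [moment]

theorem moment_eq_integral (f : Ω → ℝ) (p : MvPolynomial (κ ⊕ κ) ℂ)
    (h : ∀ ω, conjEval (u ω) p = f ω) : moment μ u p = (∫ ω, f ω ∂μ : ℝ) := by
  simp only [moment, h]
  exact integral_ofReal

namespace IsUniformUnitVector

variable [IsProbabilityMeasure μ]

theorem integrable (hu : IsUniformUnitVector μ u) {f : (κ → ℂ) → ℂ} (hf : Continuous f) :
    Integrable (fun ω => f (u ω)) μ := by
  obtain ⟨C, hC⟩ := exists_bound_of_continuous f hf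
  exact Integrable.of_bound (hf.measurable.comp hu.measurable).aestronglyMeasurable C
    (Filter.Eventually.of_forall fun ω => hC _ (hu.norm_sq ω))

theorem reindex {κ' : Type} [Fintype κ'] [DecidableEq κ'] (hu : IsUniformUnitVector μ u)
    (e : κ' ≃ κ) : IsUniformUnitVector μ fun ω i => u ω (e i) where
  measurable := measurable_pi_lambda _ fun i => (measurable_pi_apply _).comp hu.measurable
  norm_sq ω := by
    rw [← hu.norm_sq ω]
    exact e.sum_comp fun i => u ω i * star (u ω i)
  invariant W hW f hf := by
    have hW' : W.submatrix e.symm e.symm ∈ unitaryGroup κ ℂ := by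
      rw [mem_unitaryGroup_iff] at hW ⊢
      rw [star_eq_conjTranspose, conjTranspose_submatrix, submatrix_mul_equiv,
        ← star_eq_conjTranspose, hW, submatrix_one_equiv]
    have h := hu.invariant _ hW' (fun v => f fun i => v (e i))
      (hf.comp (continuous_pi fun i => continuous_apply _))
    rw [← h]
    refine integral_congr_ae (Filter.Eventually.of_forall fun ω => congrArg f ?_)
    ext i
    simp only [mulVec, dotProduct, submatrix_apply, Equiv.symm_apply_apply]
    rw [← e.sum_comp]
    simp

theorem moment_add (hu : IsUniformUnitVector μ u) (p q : MvPolynomial (κ ⊕ κ) ℂ) :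
    moment μ u (p + q) = moment μ u p + moment μ u q := by
  simp only [moment, map_add]
  exact integral_add (hu.integrable (continuous_conjEval p)) (hu.integrable (continuous_conjEval q))

theorem moment_sub (hu : IsUniformUnitVector μ u) (p q : MvPolynomial (κ ⊕ κ) ℂ) :
    moment μ u (p - q) = moment μ u p - moment μ u q := by
  rw [sub_eq_add_neg, ← neg_one_smul ℂ q, hu.moment_add, moment_smul]; ring

theorem moment_sum (hu : IsUniformUnitVector μ u) {ι : Type} (s : Finset ι)
    (p : ι → MvPolynomial (κ ⊕ κ) ℂ) :
    moment μ u (∑ i ∈ s, p i) = ∑ i ∈ s, moment μ u (p i) := by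
  simp only [moment, map_sum]
  exact integral_finsetSum _ fun i _ => hu.integrable (continuous_conjEval (p i))

theorem moment_norm_sq_mul (hu : IsUniformUnitVector μ u) (p : MvPolynomial (κ ⊕ κ) ℂ) :
    moment μ u ((∑ i, X (.inl i) * X (.inr i)) * p) = moment μ u p := by
  refine integral_congr_ae (Filter.Eventually.of_forall fun ω => ?_)
  have h := hu.norm_sq ω
  simp only [map_mul, map_sum, conjEval_inl, conjEval_inr, h, one_mul]

/-- Differentiating the invariance of the expectation along the one-parameter group generated by a
skew-Hermitian matrix. -/
theorem moment_rotation_of_skew (hu : IsUniformUnitVector μ u) (A : Matrix κ κ ℂ) (hA : Aᴴ = -A)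
    (p : MvPolynomial (κ ⊕ κ) ℂ) : moment μ u (rotation A p) = 0 := by
  obtain ⟨W, hW0, hW, hWd⟩ := exists_unitary_flow A hA
  obtain ⟨C, hC⟩ := exists_bound_of_continuous _ (continuous_conjEval (rotation A p))
  have hcont : ∀ (q : MvPolynomial (κ ⊕ κ) ℂ) (t : ℝ),
      Measurable fun ω => conjEval (W t *ᵥ u ω) q := fun q t => by
    have h : Continuous fun v : κ → ℂ => conjEval (W t *ᵥ v) q :=
      (continuous_conjEval q).comp (by fun_prop)
    exact h.measurable.comp hu.measurable
  have hint : Integrable (fun ω => conjEval (W 0 *ᵥ u ω) p) μ := by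
    simpa [hW0] using hu.integrable (continuous_conjEval p)
  have hd : ∀ (ω : Ω) (t : ℝ), HasDerivAt (fun s => conjEval (W s *ᵥ u ω) p)
      (conjEval (W t *ᵥ u ω) (rotation A p)) t := fun ω t => by
    refine hasDerivAt_conjEval A hA _ t (fun i => ?_) p
    rw [mulVec_mulVec]
    simp only [mulVec, dotProduct]
    exact HasDerivAt.fun_sum fun j _ => (hWd t i j).mul_const _
  have h := (hasDerivAt_integral_of_dominated_loc_of_deriv_le (μ := μ) (x₀ := (0 : ℝ))
    (F := fun t ω => conjEval (W t *ᵥ u ω) p)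
    (F' := fun t ω => conjEval (W t *ᵥ u ω) (rotation A p)) (bound := fun _ => C)
    Filter.univ_mem (Filter.Eventually.of_forall fun t => (hcont p t).aestronglyMeasurable) hint
    (hcont _ 0).aestronglyMeasurable
    (Filter.Eventually.of_forall fun ω t _ =>
      hC _ ((norm_sq_mulVec (hW t) _).trans (hu.norm_sq ω)))
    (integrable_const C) (Filter.Eventually.of_forall fun ω t _ => hd ω t)).2
  have hconst : (fun t => ∫ ω, conjEval (W t *ᵥ u ω) p ∂μ) = fun _ => moment μ u p := by
    ext t
    exact hu.invariant (W t) (hW t) _ (continuous_conjEval p)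
  rw [hconst] at h
  have h' := h.unique (hasDerivAt_const _ _)
  simpa [moment, hW0] using h'

/-- By complex linearity in `A`, the infinitesimal invariance extends to all matrices. -/
theorem moment_rotation (hu : IsUniformUnitVector μ u) (A : Matrix κ κ ℂ)
    (p : MvPolynomial (κ ⊕ κ) ℂ) : moment μ u (rotation A p) = 0 := by
  -- `A` is a complex combination of the skew-Hermitian matrices `A - A*` and `i (A + A*)`.
  have hdec : A = (1 / 2 : ℂ) • (A - Aᴴ) + (-Complex.I / 2) • (Complex.I • (A + Aᴴ)) := by
    ext i j
    simp only [Matrix.add_apply, Matrix.smul_apply, Matrix.sub_apply, smul_eq_mul]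
    linear_combination (1 / 2 : ℂ) * (A i j + Aᴴ i j) * Complex.I_mul_I
  rw [hdec, rotation_add, rotation_smul, rotation_smul]
  simp only [Derivation.add_apply, Derivation.smul_apply]
  rw [hu.moment_add, moment_smul, moment_smul, hu.moment_rotation_of_skew,
    hu.moment_rotation_of_skew]
  · simp
  · simp [conjTranspose_smul, add_comm]
  · simp

/-- Integration by parts on the complex sphere, for a polynomial vector field `V` of degree `k` in
the conjugate variables: the expected divergence is `dim + k` times the expected value of
`⟨u, V⟩`. -/
theorem moment_divergence (hu : IsUniformUnitVector μ u) (V : κ → MvPolynomial (κ ⊕ κ) ℂ) (k : ℕ)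
    (hV : ∀ i, conjDegree (V i) = (k : ℂ) • V i) :
    moment μ u (∑ i, pderiv (.inl i) (V i)) =
      (Fintype.card κ + k) * moment μ u (∑ i, X (.inr i) * V i) := by
  -- Infinitesimal invariance under the matrix unit `E_ij`, applied to `ū_j V_i`.
  have h0 : ∀ i j, moment μ u (X (.inl j) * pderiv (.inl i) (X (.inr j) * V i)
      - X (.inr i) * pderiv (.inr j) (X (.inr j) * V i)) = 0 := fun i j => by
    rw [← rotation_single]; exact hu.moment_rotation _ _
  have h1 : ∑ i, ∑ j, (X (.inl j) * pderiv (.inl i) (X (.inr j) * V i)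
      - X (.inr i) * pderiv (.inr j) (X (.inr j) * V i)) =
      (∑ i, X (.inl i) * X (.inr i)) * (∑ i, pderiv (.inl i) (V i))
        - ((Fintype.card κ + k : ℂ) • ∑ i, X (.inr i) * V i) := by
    have e1 : ∀ i j, X (.inl j) * pderiv (.inl i) (X (.inr j) * V i) =
        X (.inl j) * X (.inr j) * pderiv (.inl i) (V i) := fun i j => by
      simp [Derivation.leibniz, pderiv_X, mul_assoc]
    have e2 : ∀ i j, X (.inr i) * pderiv (.inr j) (X (.inr j) * V i) =
        X (.inr i) * V i + X (.inr i) * (X (.inr j) * pderiv (.inr j) (V i)) := fun i j => by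
      simp [Derivation.leibniz, pderiv_X]; ring
    simp only [e1, e2, Finset.sum_sub_distrib, Finset.sum_add_distrib, ← Finset.mul_sum,
      ← Finset.sum_mul, ← conjDegree_eq_sum, hV]
    simp only [Finset.sum_const, Finset.card_univ, mul_smul_comm, ← Finset.smul_sum, add_smul]
    simp only [← Nat.cast_smul_eq_nsmul ℂ]
  have h2 : moment μ u (∑ i, ∑ j, (X (.inl j) * pderiv (.inl i) (X (.inr j) * V i)
      - X (.inr i) * pderiv (.inr j) (X (.inr j) * V i))) = 0 := by
    rw [hu.moment_sum]
    refine Finset.sum_eq_zero fun i _ => ?_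
    rw [hu.moment_sum]
    exact Finset.sum_eq_zero fun j _ => h0 i j
  rw [h1, hu.moment_sub, moment_smul, hu.moment_norm_sq_mul] at h2
  exact sub_eq_zero.1 h2

end IsUniformUnitVector
end Stein

/-! ### The mean and the variance of the purity of a random state -/

section MatrixPurity

variable {α β : Type} [Fintype α] [Fintype β]

/-- The purity `Tr ((M M*)²)` of the reduced state of the bipartite state with amplitude matrix `M`,
written as a sum of squares to make it real. -/
def matrixPurity (M : Matrix α β ℂ) : ℝ := ∑ a, ∑ a', ‖(M * Mᴴ) a a'‖ ^ 2

theorem trace_mul_conjTranspose_sq (M : Matrix α β ℂ) :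
    (M * Mᴴ * (M * Mᴴ)).trace = matrixPurity M := by
  have h : (M * Mᴴ)ᴴ = M * Mᴴ := by simp
  nth_rewrite 2 [← h]
  simp only [trace, diag, mul_apply (M := M * Mᴴ), matrixPurity, conjTranspose_apply]
  push_cast
  exact Finset.sum_congr rfl fun i _ => Finset.sum_congr rfl fun j _ => Complex.mul_conj' _

theorem continuous_matrixPurity : Continuous (matrixPurity : Matrix α β ℂ → ℝ) := by
  unfold matrixPurity
  fun_prop

end MatrixPurity

section PurityMoments

open MvPolynomial

variable {α β : Type} [Fintype α] [DecidableEq α] [Fintype β] [DecidableEq β]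

theorem map_derivation_mul {R A l m n : Type*} [CommSemiring R] [CommSemiring A] [Algebra R A]
    [Fintype m] (D : Derivation R A A) (M : Matrix l m A) (N : Matrix m n A) :
    (M * N).map D = M.map D * N + M * N.map D := by
  ext i j
  simp [mul_apply, Derivation.leibniz, Finset.sum_add_distrib, add_comm, mul_comm]

theorem map_derivation_trace {R A m : Type*} [CommSemiring R] [CommSemiring A] [Algebra R A]
    [Fintype m] (D : Derivation R A A) (M : Matrix m m A) : D M.trace = (M.map D).trace := by
  simp [trace]

/-- The matrix of the variables `u (a, b)`. -/
def varMatrix (α β : Type) : Matrix α β (MvPolynomial (α × β ⊕ α × β) ℂ) :=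
  of fun a b => X (.inl (a, b))

/-- The formal conjugate transpose of `varMatrix`. -/
def conjVarMatrix (α β : Type) : Matrix β α (MvPolynomial (α × β ⊕ α × β) ℂ) :=
  of fun b a => X (.inr (a, b))

local notation "G" => varMatrix α β
local notation "H" => conjVarMatrix α β
local notation "𝓡" => MvPolynomial (α × β ⊕ α × β) ℂ

theorem varMatrix_map_pderiv (a : α) (b : β) :
    (G).map (pderiv (R := ℂ) (.inl (a, b))) = Matrix.single a b (1 : 𝓡) := by
  ext i j : 2
  simp [varMatrix, pderiv_X, Pi.single_apply, Matrix.single, eq_comm]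

theorem conjVarMatrix_map_pderiv (a : α) (b : β) :
    (H).map (pderiv (R := ℂ) (.inl (a, b))) = 0 := by
  ext i j : 2
  simp [conjVarMatrix, pderiv_X]

theorem varMatrix_map_conjDegree : (G).map conjDegree = 0 := by
  ext i j : 2
  simp [varMatrix, conjDegree_inl]

theorem conjVarMatrix_map_conjDegree : (H).map conjDegree = H := by
  ext i j : 2
  simp [conjVarMatrix, conjDegree_inr]

theorem sum_conj_mul_eq_trace (V : Matrix α β (MvPolynomial (α × β ⊕ α × β) ℂ)) :
    ∑ i : α × β, X (.inr i) * V i.1 i.2 = (H * V).trace := by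
  rw [Fintype.sum_prod_type, Finset.sum_comm]
  simp [trace, mul_apply, conjVarMatrix]

theorem sum_norm_sq_eq_trace :
    ∑ i : α × β, (X (.inl i) * X (.inr i) : MvPolynomial (α × β ⊕ α × β) ℂ) = (H * G).trace := by
  rw [← sum_conj_mul_eq_trace]
  exact Finset.sum_congr rfl fun i _ => by simp [varMatrix, mul_comm]

/-- The divergence of the vector field `G G* G`. -/
theorem divergence_cubic :
    ∑ i : α × β, pderiv (.inl i) ((G * H * G) i.1 i.2) =
      ((Fintype.card α + Fintype.card β : ℕ) : ℂ) • (H * G).trace := by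
  have h : ∀ i : α × β, pderiv (.inl i) ((G * H * G) i.1 i.2) =
      (H * G) i.2 i.2 + (G * H) i.1 i.1 := fun ⟨a, b⟩ => by
    change ((G * H * G).map (pderiv (R := ℂ) (.inl (a, b)))) a b = _
    simp only [map_derivation_mul, varMatrix_map_pderiv, conjVarMatrix_map_pderiv]
    simp [Matrix.mul_assoc (Matrix.single a b (1 : 𝓡)) H G]
  simp only [h]
  rw [Fintype.sum_prod_type]
  simp only [Finset.sum_add_distrib, Finset.sum_const, Finset.card_univ]
  rw [← Finset.smul_sum]
  change Fintype.card α • (H * G).trace + Fintype.card β • (G * H).trace = _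
  rw [trace_mul_comm G H, ← add_smul, Nat.cast_smul_eq_nsmul]

/-- The divergence of the vector field `G G* G G* G`. -/
theorem divergence_quintic :
    ∑ i : α × β, pderiv (.inl i) ((G * H * G * H * G) i.1 i.2) =
      ((Fintype.card α + Fintype.card β : ℕ) : ℂ) • (H * (G * H * G)).trace
        + (H * G).trace * (H * G).trace := by
  have h : ∀ i : α × β, pderiv (.inl i) ((G * H * G * H * G) i.1 i.2) =
      (H * (G * H * G)) i.2 i.2 + (G * H) i.1 i.1 * (H * G) i.2 i.2
        + (G * H * G * H) i.1 i.1 := fun ⟨a, b⟩ => by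
    change ((G * H * G * H * G).map (pderiv (R := ℂ) (.inl (a, b)))) a b = _
    have h2 : (G * H * (Matrix.single a b (1 : 𝓡)) * H * G) a b = (G * H) a a * (H * G) b b := by
      rw [Matrix.mul_assoc _ H G, mul_apply]
      rw [Finset.sum_eq_single b]
      · simp
      · intro c _ hc
        rw [mul_single_apply_of_ne (hbj := hc), zero_mul]
      · simp
    simp only [map_derivation_mul, varMatrix_map_pderiv, conjVarMatrix_map_pderiv, Matrix.mul_zero,
      add_zero, Matrix.add_mul, Matrix.add_apply, h2]
    simp [Matrix.mul_assoc]
  simp only [h]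
  rw [Fintype.sum_prod_type]
  simp only [Finset.sum_add_distrib, Finset.sum_const, Finset.card_univ, ← Finset.mul_sum,
    ← Finset.sum_mul]
  rw [← Finset.smul_sum]
  change Fintype.card α • (H * (G * H * G)).trace + (G * H).trace * (H * G).trace
    + Fintype.card β • (G * H * G * H).trace = _
  rw [trace_mul_comm G H, trace_mul_comm _ H, ← Nat.cast_smul_eq_nsmul ℂ,
    ← Nat.cast_smul_eq_nsmul ℂ, Nat.cast_add, add_smul]
  abel

/-- The divergence of the vector field `Tr ((G G*)²) G G* G`. -/
theorem divergence_purity_mul_cubic :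
    ∑ i : α × β, pderiv (.inl i) ((H * (G * H * G)).trace * (G * H * G) i.1 i.2) =
      (H * (G * H * G)).trace * (((Fintype.card α + Fintype.card β : ℕ) : ℂ) • (H * G).trace)
        + (2 : ℂ) • (H * (G * H * G * H * G)).trace := by
  have h : ∀ i : α × β, pderiv (.inl i) (H * (G * H * G)).trace =
      (2 : ℂ) • (H * G * H) i.2 i.1 := fun ⟨a, b⟩ => by
    rw [map_derivation_trace]
    simp only [map_derivation_mul, varMatrix_map_pderiv, conjVarMatrix_map_pderiv,
      Matrix.mul_zero, Matrix.zero_mul, add_zero, zero_add, Matrix.mul_add,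
      trace_add]
    have h1 : (H * (Matrix.single a b (1 : 𝓡) * H * G)).trace = (H * G * H) b a := by
      rw [trace_mul_comm, Matrix.mul_assoc, Matrix.mul_assoc, trace_single_mul]
      simp [Matrix.mul_assoc]
    have h2 : (H * (G * H * Matrix.single a b (1 : 𝓡))).trace = (H * G * H) b a := by
      rw [← Matrix.mul_assoc H, trace_mul_single]
      simp [Matrix.mul_assoc]
    rw [h1, h2, two_smul]
  rw [← divergence_cubic]
  simp only [Derivation.leibniz, smul_eq_mul, Finset.sum_add_distrib, ← Finset.mul_sum]
  congr 1
  simp only [h, mul_smul_comm, ← Finset.smul_sum]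
  congr 1
  rw [Fintype.sum_prod_type]
  change (G * H * G * (H * G * H)).trace = _
  rw [trace_mul_comm _ (H * G * H)]
  simp only [Matrix.mul_assoc]

theorem conjEval_purity (u : α × β → ℂ) :
    conjEval u (H * (G * H * G)).trace = matrixPurity (of fun a b => u (a, b)) := by
  rw [← trace_mul_conjTranspose_sq]
  have hG : (G).map (conjEval u) = of fun a b => u (a, b) := by
    ext i j; simp [varMatrix]
  have hH : (H).map (conjEval u) = (of fun a b => u (a, b))ᴴ := by
    ext i j; simp [conjVarMatrix]
  rw [trace_mul_comm, AddMonoidHom.map_trace, Matrix.map_mul, Matrix.map_mul, Matrix.map_mul, hG,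
    hH]
  simp only [Matrix.mul_assoc]

variable {Ω : Type} [MeasurableSpace Ω] {μ : Measure Ω} [IsProbabilityMeasure μ]
  {u : Ω → α × β → ℂ}

namespace IsUniformUnitVector

theorem moment_trace (hu : IsUniformUnitVector μ u) (p : MvPolynomial (α × β ⊕ α × β) ℂ) :
    moment μ u ((H * G).trace * p) = moment μ u p := by
  rw [← sum_norm_sq_eq_trace, hu.moment_norm_sq_mul]

theorem moment_purity (hu : IsUniformUnitVector μ u) :
    (Fintype.card α * Fintype.card β + 1 : ℂ) * moment μ u (H * (G * H * G)).trace =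
      Fintype.card α + Fintype.card β := by
  have h := hu.moment_divergence (fun i => (G * H * G) i.1 i.2) 1 fun i => by
    change ((G * H * G).map conjDegree) i.1 i.2 = _
    simp only [map_derivation_mul, varMatrix_map_conjDegree, conjVarMatrix_map_conjDegree]
    simp
  rw [divergence_cubic, sum_conj_mul_eq_trace, moment_smul, ← mul_one (H * G).trace,
    hu.moment_trace, moment_one] at h
  simpa using h.symm

/-- The expectation of `Tr ((G G*)³)` in terms of the mean purity. -/
theorem moment_sextic (hu : IsUniformUnitVector μ u) :
    (Fintype.card α * Fintype.card β + 2 : ℂ) * moment μ u (H * (G * H * G * H * G)).trace =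
      (Fintype.card α + Fintype.card β) * moment μ u (H * (G * H * G)).trace + 1 := by
  have h := hu.moment_divergence (fun i => (G * H * G * H * G) i.1 i.2) 2 fun i => by
    change ((G * H * G * H * G).map conjDegree) i.1 i.2 = _
    simp only [map_derivation_mul, varMatrix_map_conjDegree, conjVarMatrix_map_conjDegree]
    simp [Matrix.add_mul, two_smul]
  rw [divergence_quintic, sum_conj_mul_eq_trace, hu.moment_add, moment_smul, hu.moment_trace,
    ← mul_one (H * G).trace, hu.moment_trace, moment_one] at h
  simpa using h.symm

theorem moment_purity_sq (hu : IsUniformUnitVector μ u) :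
    (Fintype.card α * Fintype.card β + 3 : ℂ) *
        moment μ u ((H * (G * H * G)).trace * (H * (G * H * G)).trace) =
      (Fintype.card α + Fintype.card β) * moment μ u (H * (G * H * G)).trace
        + 2 * moment μ u (H * (G * H * G * H * G)).trace := by
  have h := hu.moment_divergence (fun i => (H * (G * H * G)).trace * (G * H * G) i.1 i.2) 3
    fun i => by
      have h1 : conjDegree (H * (G * H * G)).trace = (2 : ℂ) • (H * (G * H * G)).trace := by
        rw [map_derivation_trace]
        simp [map_derivation_mul, varMatrix_map_conjDegree, conjVarMatrix_map_conjDegree, two_smul]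
      have h2 : conjDegree ((G * H * G) i.1 i.2) = (G * H * G) i.1 i.2 := by
        change ((G * H * G).map conjDegree) i.1 i.2 = _
        simp only [map_derivation_mul, varMatrix_map_conjDegree, conjVarMatrix_map_conjDegree]
        simp
      simp only [Derivation.leibniz, smul_eq_mul, h1, h2, MvPolynomial.smul_eq_C_mul]
      have : (C ((3 : ℕ) : ℂ) : MvPolynomial (α × β ⊕ α × β) ℂ) = 1 + C 2 := by
        rw [← C_1, ← C_add]; norm_num
      rw [this]; ring
  have e : ∑ i : α × β, X (.inr i) * ((H * (G * H * G)).trace * (G * H * G) i.1 i.2) =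
      (H * (G * H * G)).trace * (H * (G * H * G)).trace := by
    rw [← sum_conj_mul_eq_trace (G * H * G), Finset.mul_sum]
    exact Finset.sum_congr rfl fun i _ => by ring
  rw [divergence_purity_mul_cubic, e, hu.moment_add, moment_smul, mul_smul_comm, moment_smul,
    mul_comm _ (H * G).trace, hu.moment_trace] at h
  simpa using h.symm

theorem integral_purity (hu : IsUniformUnitVector μ u) :
    ∫ ω, matrixPurity (of fun a b => u ω (a, b)) ∂μ =
      (Fintype.card α + Fintype.card β) / (Fintype.card α * Fintype.card β + 1) := by
  have h := hu.moment_purity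
  rw [moment_eq_integral (fun ω => matrixPurity (of fun a b => u ω (a, b))) _
    fun ω => conjEval_purity (u ω)] at h
  rw [eq_div_iff (by positivity), mul_comm]
  exact_mod_cast h

theorem integrable_purity (hu : IsUniformUnitVector μ u) :
    Integrable (fun ω => matrixPurity (of fun a b => u ω (a, b))) μ := by
  have h := (hu.integrable (continuous_conjEval (H * (G * H * G)).trace)).re
  simpa [conjEval_purity] using h

theorem integrable_purity_sq (hu : IsUniformUnitVector μ u) :
    Integrable (fun ω => matrixPurity (of fun a b => u ω (a, b)) ^ 2) μ := by
  have h := (hu.integrable (continuous_conjEval ((H * (G * H * G)).trace ^ 2))).re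
  refine h.congr (Filter.Eventually.of_forall fun ω => ?_)
  simp only [map_pow, conjEval_purity]
  norm_cast

/-- The variance of the purity of a uniformly random bipartite state is at most twice the inverse
square of the dimension. -/
theorem integral_purity_sub_sq_le [Nonempty α] [Nonempty β] (hu : IsUniformUnitVector μ u) :
    ∫ ω, (matrixPurity (of fun a b => u ω (a, b)) -
        (Fintype.card α + Fintype.card β) / (Fintype.card α * Fintype.card β + 1)) ^ 2 ∂μ ≤
      2 / ((Fintype.card α : ℝ) * Fintype.card β) ^ 2 := by
  have h1 := hu.integral_purity
  have h2 := hu.moment_sextic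
  have h3 := hu.moment_purity_sq
  have hp := moment_eq_integral (μ := μ) (fun ω => matrixPurity (of fun a b => u ω (a, b))) _
    fun ω => conjEval_purity (u ω)
  rw [moment_eq_integral (μ := μ) (u := u)
    (fun ω => matrixPurity (of fun a b => u ω (a, b)) ^ 2) _
    fun ω => by rw [map_mul, conjEval_purity, ← Complex.ofReal_mul, sq]] at h3
  rw [hp, h1] at h2 h3
  have i1 := hu.integrable_purity
  have i2 := hu.integrable_purity_sq
  set da : ℝ := (Fintype.card α : ℝ) with hda
  set db : ℝ := (Fintype.card β : ℝ) with hdb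
  have ha : 0 < da := by rw [hda]; exact_mod_cast Fintype.card_pos
  have hb : 0 < db := by rw [hdb]; exact_mod_cast Fintype.card_pos
  set m := (da + db) / (da * db + 1) with hm
  set E2 := ∫ ω, matrixPurity (of fun a b => u ω (a, b)) ^ 2 ∂μ with hE2
  have hE : ∫ ω, (matrixPurity (of fun a b => u ω (a, b)) - m) ^ 2 ∂μ = E2 - m ^ 2 := by
    have e : ∀ x : ℝ, (x - m) ^ 2 = x ^ 2 - (2 * m * x - m ^ 2) := fun x => by ring
    simp only [e]
    have i3 : Integrable (fun ω => 2 * m * matrixPurity (of fun a b => u ω (a, b)) - m ^ 2) μ :=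
      (i1.const_mul _).sub (integrable_const _)
    rw [integral_sub i2 i3,
      integral_sub (i1.const_mul _) (integrable_const _), integral_const_mul, h1]
    simp
    ring
  rw [hE]
  have h4 : (da * db + 3) * E2 = (da + db) * m + 2 * (((da + db) * m + 1) / (da * db + 2)) := by
    have h5 : moment μ u (H * (G * H * G * H * G)).trace =
        ((((da + db) * m + 1) / (da * db + 2) : ℝ) : ℂ) := by
      have h6 : (((da * db + 2 : ℝ)) : ℂ) ≠ 0 := Complex.ofReal_ne_zero.2 (by positivity)
      rw [Complex.ofReal_div, eq_div_iff h6]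
      simp only [hda, hdb]
      push_cast
      linear_combination h2
    rw [h5] at h3
    rw [← Complex.ofReal_inj, hda, hdb]
    rw [hda, hdb] at h3
    push_cast at h3 ⊢
    exact h3
  have hD : 0 < da * db := by positivity
  have h5 : E2 = ((da + db) * m + 2 * (((da + db) * m + 1) / (da * db + 2))) / (da * db + 3) := by
    rw [← h4]; field_simp
  have h6 : E2 - m ^ 2 = 2 / ((da * db + 2) * (da * db + 3))
      - 2 * (da + db) ^ 2 / ((da * db + 1) ^ 2 * (da * db + 2) * (da * db + 3)) := by
    rw [h5, hm]; field_simp; ring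
  -- The part of the variance that depends on `da + db` is negative and can be dropped.
  have h7 : 0 ≤ 2 * (da + db) ^ 2 / ((da * db + 1) ^ 2 * (da * db + 2) * (da * db + 3)) := by
    positivity
  have h8 : 2 / ((da * db + 2) * (da * db + 3)) ≤ 2 / (da * db) ^ 2 := by
    gcongr
    nlinarith
  linarith

end IsUniformUnitVector
end PurityMoments

/-! ### Entropy of density matrices -/

section Entropy

variable {m m' : Type} [Fintype m] [DecidableEq m] [Fintype m'] [DecidableEq m']

/-- The entropy depends only on the characteristic polynomial, which makes it comparable across
index types. -/
theorem vonNeumannEntropy_eq_sum_roots (ρ : Matrix m m ℂ) (hρ : ρ.IsHermitian) :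
    vonNeumannEntropy ρ hρ =
      (ρ.charpoly.roots.map fun z => Real.negMulLog z.re).sum / Real.log 2 := by
  rw [vonNeumannEntropy, hρ.roots_charpoly_eq_eigenvalues, Multiset.map_map]
  rfl

theorem vonNeumannEntropy_congr {ρ : Matrix m m ℂ} {σ : Matrix m' m' ℂ} (hρ : ρ.IsHermitian)
    (hσ : σ.IsHermitian) (h : ρ.charpoly = σ.charpoly) :
    vonNeumannEntropy ρ hρ = vonNeumannEntropy σ hσ := by
  rw [vonNeumannEntropy_eq_sum_roots, vonNeumannEntropy_eq_sum_roots, h]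

/-- `M M*` and `M* M` have the same spectrum up to zeros, which carry no entropy. -/
theorem vonNeumannEntropy_mul_conjTranspose (M : Matrix m m' ℂ) (h : (M * Mᴴ).IsHermitian)
    (h' : (Mᴴ * M).IsHermitian) :
    vonNeumannEntropy (M * Mᴴ) h = vonNeumannEntropy (Mᴴ * M) h' := by
  rw [vonNeumannEntropy_eq_sum_roots, vonNeumannEntropy_eq_sum_roots]
  congr 1
  have key := congrArg (fun p : Polynomial ℂ =>
    (p.roots.map fun z => Real.negMulLog z.re).sum) (charpoly_mul_comm' M Mᴴ)
  have hne : ∀ (k : ℕ) {q : Polynomial ℂ}, q.Monic → Polynomial.X ^ k * q ≠ 0 := fun k q hq =>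
    mul_ne_zero (pow_ne_zero _ Polynomial.X_ne_zero) hq.ne_zero
  simp only [Polynomial.roots_mul (hne _ (charpoly_monic _)), Polynomial.roots_X_pow] at key
  simpa [Multiset.nsmul_singleton] using key

variable {ρ : Matrix m m ℂ}

theorem trace_pow_eq_sum_eigenvalues (hρ : ρ.IsHermitian) (k : ℕ) :
    (ρ ^ k).trace = ((∑ i, hρ.eigenvalues i ^ k : ℝ) : ℂ) := by
  conv_lhs => rw [hρ.spectral_theorem]
  rw [← map_pow, Unitary.conjStarAlgAut_apply, trace_mul_cycle, Unitary.coe_star_mul_self, one_mul,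
    diagonal_pow, trace_diagonal]
  simp

theorem sum_eigenvalues_eq_one (hρ : ρ.IsHermitian) (htr : ρ.trace = 1) :
    ∑ i, hρ.eigenvalues i = 1 := by
  have h := trace_pow_eq_sum_eigenvalues hρ 1
  simp only [pow_one, htr] at h
  exact_mod_cast h.symm

/-- The tangent line of the logarithm at `1 / c`; for `c = 1 / Tr ρ²` this is the bound of the
entropy by the Rényi entropy of order two. -/
theorem le_vonNeumannEntropy (hρ : ρ.PosSemidef) (htr : ρ.trace = 1) {c : ℝ} (hc : 0 < c) :
    Real.log c - c * ((ρ * ρ).trace).re + 1 ≤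
      vonNeumannEntropy ρ hρ.isHermitian * Real.log 2 := by
  have h2 := trace_pow_eq_sum_eigenvalues hρ.isHermitian 2
  rw [sq] at h2
  rw [vonNeumannEntropy, div_mul_cancel₀ _ (Real.log_pos one_lt_two).ne', h2, Complex.ofReal_re]
  have h1 := sum_eigenvalues_eq_one hρ.isHermitian htr
  have h : ∀ i, hρ.isHermitian.eigenvalues i * Real.log c
      - c * hρ.isHermitian.eigenvalues i ^ 2 + hρ.isHermitian.eigenvalues i ≤
      Real.negMulLog (hρ.isHermitian.eigenvalues i) := fun i => by
    rcases (hρ.eigenvalues_nonneg i).eq_or_lt with h0 | h0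
    · simp [← h0]
    · have h3 := Real.log_le_sub_one_of_pos (mul_pos hc h0)
      rw [Real.log_mul hc.ne' h0.ne'] at h3
      have h4 := mul_le_mul_of_nonneg_left h3 h0.le
      rw [Real.negMulLog]
      linarith
  have h5 := Finset.sum_le_sum fun i (_ : i ∈ Finset.univ) => h i
  rw [Finset.sum_add_distrib, Finset.sum_sub_distrib, ← Finset.sum_mul, ← Finset.mul_sum, h1] at h5
  linarith

theorem vonNeumannEntropy_nonneg (hρ : ρ.PosSemidef) (htr : ρ.trace = 1) :
    0 ≤ vonNeumannEntropy ρ hρ.isHermitian := by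
  refine div_nonneg (Finset.sum_nonneg fun i _ => ?_) (Real.log_pos one_lt_two).le
  refine Real.negMulLog_nonneg (hρ.eigenvalues_nonneg i) ?_
  rw [← sum_eigenvalues_eq_one hρ.isHermitian htr]
  exact Finset.single_le_sum (fun j _ => hρ.eigenvalues_nonneg j) (Finset.mem_univ i)

theorem vonNeumannEntropy_le_log_card (hρ : ρ.PosSemidef) (htr : ρ.trace = 1) :
    vonNeumannEntropy ρ hρ.isHermitian * Real.log 2 ≤ Real.log (Fintype.card m) := by
  rw [vonNeumannEntropy, div_mul_cancel₀ _ (Real.log_pos one_lt_two).ne']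
  have h1 := sum_eigenvalues_eq_one hρ.isHermitian htr
  have hne : Nonempty m := by
    by_contra hne
    rw [not_nonempty_iff] at hne
    simp at h1
  have hd : (0 : ℝ) < Fintype.card m := by exact_mod_cast Fintype.card_pos
  have h : ∀ i, Real.negMulLog (hρ.isHermitian.eigenvalues i) ≤
      hρ.isHermitian.eigenvalues i * Real.log (Fintype.card m)
        + ((Fintype.card m : ℝ)⁻¹ - hρ.isHermitian.eigenvalues i) := fun i => by
    rcases (hρ.eigenvalues_nonneg i).eq_or_lt with h0 | h0
    · simp [← h0]
    · have h3 := Real.log_le_sub_one_of_pos (inv_pos.2 (mul_pos hd h0))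
      rw [Real.log_inv, Real.log_mul hd.ne' h0.ne'] at h3
      have h4 := mul_le_mul_of_nonneg_left h3 h0.le
      have h5 : hρ.isHermitian.eigenvalues i *
          ((Fintype.card m : ℝ) * hρ.isHermitian.eigenvalues i)⁻¹ = (Fintype.card m : ℝ)⁻¹ := by
        field_simp
      rw [Real.negMulLog]
      linarith
  have h5 := Finset.sum_le_sum fun i (_ : i ∈ Finset.univ) => h i
  rw [Finset.sum_add_distrib, Finset.sum_sub_distrib, ← Finset.sum_mul, h1] at h5
  simp only [Finset.sum_const, Finset.card_univ, nsmul_eq_mul, mul_inv_cancel₀ hd.ne'] at h5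
  linarith

/-- The purity is smallest for the maximally mixed state. -/
theorem one_le_card_mul_trace_sq (hρ : ρ.PosSemidef) (htr : ρ.trace = 1) :
    1 ≤ (Fintype.card m : ℝ) * ((ρ * ρ).trace).re := by
  rcases isEmpty_or_nonempty m with hm | hm
  · simp [trace] at htr
  · have h1 := le_vonNeumannEntropy hρ htr (c := Fintype.card m)
      (by exact_mod_cast Fintype.card_pos)
    have h2 := vonNeumannEntropy_le_log_card hρ htr
    linarith

/-- On density matrices the entropy is a uniform limit of traces of polynomials. -/
theorem continuous_vonNeumannEntropy {Y : Type} [TopologicalSpace Y] (ρ : Y → Matrix m m ℂ)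
    (hc : Continuous ρ) (hρ : ∀ y, (ρ y).PosSemidef) (htr : ∀ y, (ρ y).trace = 1) :
    Continuous fun y => vonNeumannEntropy (ρ y) (hρ y).isHermitian := by
  unfold vonNeumannEntropy
  refine Continuous.div_const (continuous_of_uniform_approx_of_continuous fun v hv => ?_) _
  obtain ⟨ε, hε, hv⟩ := Metric.mem_uniformity_dist.1 hv
  have hd : (0 : ℝ) < Fintype.card m + 1 := by positivity
  obtain ⟨p, hp⟩ := exists_polynomial_near_of_continuousOn 0 1 Real.negMulLog
    Real.continuous_negMulLog.continuousOn (ε / (Fintype.card m + 1)) (div_pos hε hd)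
  refine ⟨fun y => ∑ k ∈ Finset.range (p.natDegree + 1), p.coeff k * ((ρ y ^ k).trace).re, ?_,
    fun y => hv ?_⟩
  · refine continuous_finsetSum _ fun k _ => continuous_const.mul ?_
    exact Complex.continuous_re.comp (hc.pow k).matrix_trace
  · have h1 : ∑ k ∈ Finset.range (p.natDegree + 1), p.coeff k * ((ρ y ^ k).trace).re =
        ∑ i, p.eval ((hρ y).isHermitian.eigenvalues i) := by
      simp only [trace_pow_eq_sum_eigenvalues (hρ y).isHermitian, Complex.ofReal_re,
        Finset.mul_sum, Polynomial.eval_eq_sum_range]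
      exact Finset.sum_comm
    beta_reduce
    rw [h1, dist_comm, Real.dist_eq, ← Finset.sum_sub_distrib]
    have h2 : ∀ i, |p.eval ((hρ y).isHermitian.eigenvalues i) -
        Real.negMulLog ((hρ y).isHermitian.eigenvalues i)| ≤ ε / (Fintype.card m + 1) := fun i => by
      refine (hp _ ⟨(hρ y).eigenvalues_nonneg i, ?_⟩).le
      rw [← sum_eigenvalues_eq_one (hρ y).isHermitian (htr y)]
      exact Finset.single_le_sum (fun j _ => (hρ y).eigenvalues_nonneg j) (Finset.mem_univ i)
    refine (Finset.abs_sum_le_sum_abs _ _).trans_lt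
      ((Finset.sum_le_sum fun i _ => h2 i).trans_lt ?_)
    rw [Finset.sum_const, Finset.card_univ, nsmul_eq_mul, mul_div_assoc', div_lt_iff₀ hd]
    linarith

end Entropy

/-! ### Reduced states of complementary regions -/

section States

variable {ι : Type} [Fintype ι] [DecidableEq ι]

/-- The amplitudes of `ψ` as a matrix, with the configuration of the sites in `A` as row index and
that of the remaining sites as column index. -/
def amplitudeMatrix (A : Finset ι) (ψ : Bits ι → ℂ) :
    Matrix (Bits {i // i ∈ A}) (Bits {i // i ∉ A}) ℂ :=
  of fun x z => ψ (glue A x z)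

theorem reducedDensity_eq_mul (ψ : Bits ι → ℂ) (A : Finset ι) :
    reducedDensity ψ A = amplitudeMatrix A ψ * (amplitudeMatrix A ψ)ᴴ := by
  ext x y
  simp [reducedDensity, amplitudeMatrix, mul_apply]

/-- Gluing configurations, as a bijection. -/
def glueEquiv (A : Finset ι) : Bits {i // i ∈ A} × Bits {i // i ∉ A} ≃ Bits ι :=
  (Equiv.piEquivPiSubtypeProd (· ∈ A) fun _ => Fin 2).symm

theorem reducedDensity_posSemidef (ψ : Bits ι → ℂ) (A : Finset ι) :
    (reducedDensity ψ A).PosSemidef := by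
  rw [reducedDensity_eq_mul]
  exact posSemidef_self_mul_conjTranspose _

theorem trace_reducedDensity (ψ : Bits ι → ℂ) (A : Finset ι) :
    (reducedDensity ψ A).trace = ∑ x, ψ x * star (ψ x) := by
  rw [← (glueEquiv A).sum_comp, Fintype.sum_prod_type]
  rfl

theorem card_bits (A : Finset ι) : Fintype.card (Bits {i // i ∈ A}) = 2 ^ A.card := by
  simp

theorem card_bits_not_mem (A : Finset ι) : Fintype.card (Bits {i // i ∉ A}) = 2 ^ Aᶜ.card := by
  rw [Fintype.card_fun, Fintype.card_fin, Fintype.card_subtype_compl, Fintype.card_coe,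
    Finset.card_compl]

theorem entropy_nonneg {ψ : Bits ι → ℂ} (hψ : ∑ x, ψ x * star (ψ x) = 1) (A : Finset ι) :
    0 ≤ entropy ψ A :=
  vonNeumannEntropy_nonneg (reducedDensity_posSemidef ψ A) ((trace_reducedDensity ψ A).trans hψ)

theorem entropy_le_card {ψ : Bits ι → ℂ} (hψ : ∑ x, ψ x * star (ψ x) = 1) (A : Finset ι) :
    entropy ψ A ≤ A.card := by
  have h := vonNeumannEntropy_le_log_card (reducedDensity_posSemidef ψ A)
    ((trace_reducedDensity ψ A).trans hψ)
  rw [card_bits, Nat.cast_pow, Real.log_pow] at h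
  exact le_of_mul_le_mul_right h (Real.log_pos one_lt_two)

/-- Passing to the complementary region transposes the amplitude matrix. -/
theorem amplitudeMatrix_compl (A : Finset ι) : ∃ (f : Bits {i // i ∈ Aᶜ} ≃ Bits {i // i ∉ A})
    (g : Bits {i // i ∉ Aᶜ} ≃ Bits {i // i ∈ A}), ∀ ψ : Bits ι → ℂ,
      amplitudeMatrix Aᶜ ψ = (amplitudeMatrix A ψ)ᵀ.submatrix f g := by
  refine ⟨(Equiv.subtypeEquivRight fun i => Finset.mem_compl).arrowCongr (Equiv.refl _),
    (Equiv.subtypeEquivRight fun i => by simp).arrowCongr (Equiv.refl _), fun ψ => ?_⟩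
  ext x z
  simp only [amplitudeMatrix, of_apply, submatrix_apply, transpose_apply]
  congr 1
  ext i
  by_cases h : i ∈ A <;> simp [glue, h] <;> rfl

theorem submatrix_mul_conjTranspose {α β α' β' : Type} [Fintype β] [Fintype β']
    (M : Matrix α β ℂ) (f : α' → α) (g : β' ≃ β) :
    M.submatrix f g * (M.submatrix f g)ᴴ = (M * Mᴴ).submatrix f f := by
  rw [conjTranspose_submatrix, submatrix_mul_equiv]

theorem transpose_mul_conjTranspose {α β : Type} [Fintype α] (M : Matrix α β ℂ) :
    Mᵀ * Mᵀᴴ = (Mᴴ * M)ᵀ := by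
  rw [transpose_mul]; rfl

theorem charpoly_submatrix_equiv {m m' : Type} [Fintype m] [DecidableEq m] [Fintype m']
    [DecidableEq m'] (M : Matrix m m ℂ) (f : m' ≃ m) :
    (M.submatrix f f).charpoly = M.charpoly :=
  charpoly_reindex f.symm M

/-- Complementary regions of a pure state have the same entropy. -/
theorem entropy_compl (ψ : Bits ι → ℂ) (A : Finset ι) : entropy ψ Aᶜ = entropy ψ A := by
  obtain ⟨f, g, h⟩ := amplitudeMatrix_compl A
  have h1 : (amplitudeMatrix A ψ * (amplitudeMatrix A ψ)ᴴ).IsHermitian :=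
    isHermitian_mul_conjTranspose_self _
  have h2 : ((amplitudeMatrix A ψ)ᴴ * amplitudeMatrix A ψ).IsHermitian :=
    isHermitian_conjTranspose_mul_self _
  have h3 : (reducedDensity ψ Aᶜ).charpoly =
      ((amplitudeMatrix A ψ)ᴴ * amplitudeMatrix A ψ).charpoly := by
    rw [reducedDensity_eq_mul, h, submatrix_mul_conjTranspose, transpose_mul_conjTranspose,
      charpoly_submatrix_equiv, charpoly_transpose]
  calc entropy ψ Aᶜ = vonNeumannEntropy _ h2 := vonNeumannEntropy_congr _ _ h3
    _ = vonNeumannEntropy _ h1 := (vonNeumannEntropy_mul_conjTranspose _ h1 h2).symm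
    _ = entropy ψ A := vonNeumannEntropy_congr _ _ (by rw [reducedDensity_eq_mul])

end States

/-! ### States with a reference qubit -/

section Reference

variable {κ : Type} [Fintype κ] [DecidableEq κ]

/-- The amplitudes of `Ψ` with the reference qubit in the basis state `r`. -/
def slice (Ψ : Bits (Option κ) → ℂ) (r : Fin 2) : Bits κ → ℂ := fun s => Ψ fun o => o.elim r s

/-- The configurations of a region that does not contain the reference. -/
def bitsMapSome (Q : Finset κ) :
    Bits {o // o ∈ Q.map Function.Embedding.some} ≃ Bits {i // i ∈ Q} where
  toFun x i := x ⟨some i.1, by simp [i.2]⟩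
  invFun y := fun
    | ⟨none, h⟩ => absurd h (by simp)
    | ⟨some i, h⟩ => y ⟨i, by simpa using h⟩
  left_inv x := by
    ext ⟨o, h⟩
    cases o with
    | none => simp at h
    | some i => rfl
  right_inv y := rfl

/-- The configurations of the complement of such a region, split into the value at the reference and
the configuration of the remaining sites. -/
def bitsNotMapSome (Q : Finset κ) :
    Bits {o // o ∉ Q.map Function.Embedding.some} ≃ Fin 2 × Bits {i // i ∉ Q} where
  toFun x := (x ⟨none, by simp⟩, fun i => x ⟨some i.1, by simp [i.2]⟩)
  invFun y := fun
    | ⟨none, _⟩ => y.1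
    | ⟨some i, h⟩ => y.2 ⟨i, by simpa using h⟩
  left_inv x := by
    ext ⟨o, h⟩
    cases o <;> rfl
  right_inv y := rfl

theorem glue_map_some (Q : Finset κ) (x : Bits {o // o ∈ Q.map Function.Embedding.some})
    (z : Bits {o // o ∉ Q.map Function.Embedding.some}) :
    glue (Q.map Function.Embedding.some) x z =
      fun o => o.elim (bitsNotMapSome Q z).1 (glue Q (bitsMapSome Q x) (bitsNotMapSome Q z).2) := by
  funext o
  cases o with
  | none => simp [glue, bitsNotMapSome]
  | some i => by_cases h : i ∈ Q <;> simp [glue, h, bitsNotMapSome, bitsMapSome]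

/-- On a region without the reference, the reduced state is the sum of those of the two slices. -/
theorem reducedDensity_map_some (Ψ : Bits (Option κ) → ℂ) (Q : Finset κ) :
    reducedDensity Ψ (Q.map Function.Embedding.some) =
      (∑ r, amplitudeMatrix Q (slice Ψ r) * (amplitudeMatrix Q (slice Ψ r))ᴴ).submatrix
        (bitsMapSome Q) (bitsMapSome Q) := by
  ext x y
  simp only [reducedDensity, of_apply, submatrix_apply, Matrix.sum_apply, mul_apply,
    conjTranspose_apply, glue_map_some]
  rw [← Fintype.sum_prod_type', ← (bitsNotMapSome Q).sum_comp]
  rfl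

theorem trace_submatrix_equiv {m m' : Type} [Fintype m] [Fintype m'] (M : Matrix m m ℂ)
    (e : m' ≃ m) : (M.submatrix e e).trace = M.trace :=
  e.sum_comp fun i => M i i

theorem trace_reducedDensity_sq_map_some (Ψ : Bits (Option κ) → ℂ) (Q : Finset κ) :
    (reducedDensity Ψ (Q.map Function.Embedding.some) *
        reducedDensity Ψ (Q.map Function.Embedding.some)).trace =
      ((∑ r, amplitudeMatrix Q (slice Ψ r) * (amplitudeMatrix Q (slice Ψ r))ᴴ) *
        ∑ r, amplitudeMatrix Q (slice Ψ r) * (amplitudeMatrix Q (slice Ψ r))ᴴ).trace := by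
  rw [reducedDensity_map_some, submatrix_mul_equiv, trace_submatrix_equiv]

theorem trace_reducedDensity_sq_map_some_compl (Ψ : Bits (Option κ) → ℂ) (Q : Finset κ) :
    (reducedDensity Ψ (Qᶜ.map Function.Embedding.some) *
        reducedDensity Ψ (Qᶜ.map Function.Embedding.some)).trace =
      ((∑ r, (amplitudeMatrix Q (slice Ψ r))ᴴ * amplitudeMatrix Q (slice Ψ r)) *
        ∑ r, (amplitudeMatrix Q (slice Ψ r))ᴴ * amplitudeMatrix Q (slice Ψ r)).trace := by
  obtain ⟨f, g, h⟩ := amplitudeMatrix_compl Q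
  have e : ∑ r, amplitudeMatrix Qᶜ (slice Ψ r) * (amplitudeMatrix Qᶜ (slice Ψ r))ᴴ =
      (∑ r, (amplitudeMatrix Q (slice Ψ r))ᴴ * amplitudeMatrix Q (slice Ψ r))ᵀ.submatrix f f := by
    simp only [h, submatrix_mul_conjTranspose, transpose_mul_conjTranspose, Fin.sum_univ_two,
      transpose_add, submatrix_add]
    rfl
  rw [trace_reducedDensity_sq_map_some, e, submatrix_mul_equiv, trace_submatrix_equiv,
    ← transpose_mul, trace_transpose]

section Probe

variable {α β : Type} [Fintype α] [Fintype β]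

/-- The purity of `A + w B` as a Laurent polynomial in the phase `w`. -/
theorem trace_add_smul (A B : Matrix α β ℂ) (w : ℂ) (hw : w * star w = 1) :
    ((A + w • B) * (A + w • B)ᴴ * ((A + w • B) * (A + w • B)ᴴ)).trace =
      ((A * Aᴴ + B * Bᴴ) * (A * Aᴴ + B * Bᴴ)).trace
        + star w ^ 2 * (A * Bᴴ * (A * Bᴴ)).trace + w ^ 2 * (B * Aᴴ * (B * Aᴴ)).trace
        + 2 * star w * ((A * Aᴴ + B * Bᴴ) * (A * Bᴴ)).trace
        + 2 * w * ((A * Aᴴ + B * Bᴴ) * (B * Aᴴ)).trace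
        + 2 * (A * Bᴴ * (B * Aᴴ)).trace := by
  have e : (A + w • B) * (A + w • B)ᴴ =
      (A * Aᴴ + B * Bᴴ) + star w • (A * Bᴴ) + w • (B * Aᴴ) := by
    simp only [conjTranspose_add, conjTranspose_smul, Matrix.mul_add, Matrix.add_mul,
      Matrix.mul_smul, Matrix.smul_mul, smul_add, smul_smul, hw, mul_comm (star w) w, one_smul]
    abel
  rw [e]
  generalize A * Aᴴ + B * Bᴴ = S
  generalize hV : A * Bᴴ = V
  generalize hV' : B * Aᴴ = V'
  simp only [Matrix.mul_add, Matrix.add_mul, Matrix.mul_smul, Matrix.smul_mul,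
    trace_add, trace_smul, smul_eq_mul]
  rw [trace_mul_comm V S, trace_mul_comm V' S, trace_mul_comm V' V]
  linear_combination 2 * (V * V').trace * hw

/-- The six vectors that represent the eigenvectors of the three Pauli matrices in the plane spanned
by `v 0` and `v 1`.  They form a complex projective two-design.  They are scaled so as to be unit
vectors when `v 0` and `v 1` are orthogonal of norm `1 / √2`, as the slices of an encoded state
are. -/
def probe {E : Type} [AddCommGroup E] [Module ℂ E] (v : Fin 2 → E) : Fin 6 → E :=
  ![((√2 : ℝ) : ℂ) • v 0, ((√2 : ℝ) : ℂ) • v 1, v 0 + (1 : ℂ) • v 1, v 0 + (-1 : ℂ) • v 1,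
    v 0 + Complex.I • v 1, v 0 + (-Complex.I) • v 1]

theorem probe_map {E F : Type} [AddCommGroup E] [Module ℂ E] [AddCommGroup F] [Module ℂ F]
    (l : E →ₗ[ℂ] F) (v : Fin 2 → E) (j : Fin 6) : probe (fun r => l (v r)) j = l (probe v j) := by
  fin_cases j <;> simp [probe]

theorem matrixPurity_sqrt_two_smul (A : Matrix α β ℂ) :
    (matrixPurity (((√2 : ℝ) : ℂ) • A) : ℂ) = 4 * (A * Aᴴ * (A * Aᴴ)).trace := by
  have h : ((√2 : ℝ) : ℂ) * star ((√2 : ℝ) : ℂ) = 2 := by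
    rw [Complex.star_def, Complex.conj_ofReal, ← Complex.ofReal_mul,
      Real.mul_self_sqrt zero_le_two]
    norm_num
  rw [← trace_mul_conjTranspose_sq]
  simp only [conjTranspose_smul, Matrix.mul_smul, Matrix.smul_mul, smul_smul, trace_smul,
    smul_eq_mul]
  linear_combination (((√2 : ℝ) : ℂ) * star ((√2 : ℝ) : ℂ) + 2) * (A * Aᴴ * (A * Aᴴ)).trace * h

/-- The two-design property of the probes: the purities of `v 0 ⊗ e₀ + v 1 ⊗ e₁` on a region with
and without the reference are determined by the purities of the probes. -/
theorem trace_sq_add_trace_sq (M : Fin 2 → Matrix α β ℂ) :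
    ((∑ r, M r * (M r)ᴴ) * ∑ r, M r * (M r)ᴴ).trace +
        ((∑ r, (M r)ᴴ * M r) * ∑ r, (M r)ᴴ * M r).trace =
      ((1 / 4 * ∑ j, matrixPurity (probe M j) : ℝ) : ℂ) := by
  have h1 := trace_add_smul (M 0) (M 1) 1 (by simp)
  have h2 := trace_add_smul (M 0) (M 1) (-1) (by simp)
  have h3 := trace_add_smul (M 0) (M 1) Complex.I (by simp)
  have h4 := trace_add_smul (M 0) (M 1) (-Complex.I) (by simp)
  rw [trace_mul_conjTranspose_sq] at h1 h2 h3 h4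
  have h5 : (((M 0)ᴴ * M 0 + (M 1)ᴴ * M 1) * ((M 0)ᴴ * M 0 + (M 1)ᴴ * M 1)).trace =
      (M 0 * (M 0)ᴴ * (M 0 * (M 0)ᴴ)).trace + (M 1 * (M 1)ᴴ * (M 1 * (M 1)ᴴ)).trace
        + 2 * (M 0 * (M 1)ᴴ * (M 1 * (M 0)ᴴ)).trace := by
    have c : ∀ A B : Matrix α β ℂ, (Aᴴ * A * (Bᴴ * B)).trace = (A * Bᴴ * (B * Aᴴ)).trace :=
      fun A B => by
        rw [Matrix.mul_assoc, trace_mul_comm]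
        simp only [Matrix.mul_assoc]
    simp only [Matrix.mul_add, Matrix.add_mul, trace_add]
    rw [trace_mul_comm ((M 1)ᴴ * M 1) ((M 0)ᴴ * M 0), c, c, c]
    ring
  simp only [Fin.sum_univ_two]
  rw [h5]
  simp only [probe, Fin.sum_univ_six]
  simp only [cons_val_zero, cons_val_one, cons_val]
  push_cast
  -- In the sum over the fourth roots of unity `w` only the terms of degree zero in `w` survive.
  rw [matrixPurity_sqrt_two_smul, matrixPurity_sqrt_two_smul, h1, h2, h3, h4]
  simp only [star_one, star_neg, Complex.star_def, Complex.conj_I, neg_sq, one_pow, Complex.I_sq]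
  ring

end Probe

/-- The mean purity of a region over the six probes of a state with a reference qubit. -/
def meanPurity (Ψ : Bits (Option κ) → ℂ) (P : Finset κ) : ℝ :=
  1 / 6 * ∑ j, matrixPurity (amplitudeMatrix P (probe (slice Ψ) j))

theorem probe_amplitudeMatrix (Ψ : Bits (Option κ) → ℂ) (P : Finset κ) (j : Fin 6) :
    probe (fun r => amplitudeMatrix P (slice Ψ r)) j = amplitudeMatrix P (probe (slice Ψ) j) :=
  probe_map (E := Bits κ → ℂ)
    { toFun := amplitudeMatrix P, map_add' := fun _ _ => rfl, map_smul' := fun _ _ => rfl } _ j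

theorem purity_add_purity_compl (Ψ : Bits (Option κ) → ℂ) (P : Finset κ) :
    ((reducedDensity Ψ (P.map Function.Embedding.some) *
        reducedDensity Ψ (P.map Function.Embedding.some)).trace).re +
      ((reducedDensity Ψ (Pᶜ.map Function.Embedding.some) *
        reducedDensity Ψ (Pᶜ.map Function.Embedding.some)).trace).re =
      3 / 2 * meanPurity Ψ P := by
  have h := trace_sq_add_trace_sq fun r => amplitudeMatrix P (slice Ψ r)
  rw [← trace_reducedDensity_sq_map_some, ← trace_reducedDensity_sq_map_some_compl] at h
  rw [← Complex.add_re, h, Complex.ofReal_re, meanPurity]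
  simp only [probe_amplitudeMatrix]
  ring

variable {Ψ : Bits (Option κ) → ℂ}

/-- If the probes are nearly maximally mixed on `P`, then `Pᶜ`, and hence also `P` together with the
reference, has nearly `P.card + 1` bits of entropy, the most that `P` and the reference can have. -/
theorem le_entropy_map_some_compl (hΨ : ∑ x, Ψ x * star (Ψ x) = 1) (P : Finset κ) :
    (P.card + 1) * Real.log 2 - 3 * (2 ^ P.card * meanPurity Ψ P - 1) ≤
      entropy Ψ (Pᶜ.map Function.Embedding.some) * Real.log 2 := by
  have h1 := le_vonNeumannEntropy (reducedDensity_posSemidef Ψ (Pᶜ.map Function.Embedding.some))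
    ((trace_reducedDensity Ψ _).trans hΨ) (c := 2 ^ (P.card + 1)) (by positivity)
  have h2 := one_le_card_mul_trace_sq
    (reducedDensity_posSemidef Ψ (P.map Function.Embedding.some))
    ((trace_reducedDensity Ψ _).trans hΨ)
  have h3 := purity_add_purity_compl Ψ P
  rw [card_bits, Finset.card_map, Nat.cast_pow, Nat.cast_ofNat] at h2
  rw [Real.log_pow] at h1
  push_cast at h1
  rw [eq_sub_of_add_eq' h3] at h1
  refine le_trans ?_ h1
  rw [pow_succ]
  linarith

theorem entropy_reference (hΨ : ∑ x, Ψ x * star (Ψ x) = 1)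
    (h : meanPurity Ψ ∅ = 1) : entropy Ψ {none} = 1 := by
  have hl := Real.log_pos one_lt_two
  refine le_antisymm (by simpa using entropy_le_card hΨ {none}) ?_
  -- The complement of the empty region is the complement of the reference.
  have h1 := le_entropy_map_some_compl hΨ ∅
  have h2 : (∅ᶜ : Finset κ).map Function.Embedding.some = ({none} : Finset (Option κ))ᶜ := by
    ext o; cases o <;> simp
  rw [h2, entropy_compl, h] at h1
  simp only [Finset.card_empty, Nat.cast_zero, pow_zero] at h1
  nlinarith

theorem mutualInfo_eq (P : Finset κ) :
    mutualInfo Ψ {none} (P.map Function.Embedding.some) = entropy Ψ {none} +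
      entropy Ψ (P.map Function.Embedding.some) - entropy Ψ (Pᶜ.map Function.Embedding.some) := by
  have h : (Pᶜ : Finset κ).map Function.Embedding.some =
      ({none} ∪ P.map Function.Embedding.some : Finset (Option κ))ᶜ := by
    ext o; cases o <;> simp
  rw [mutualInfo, h, entropy_compl]

theorem mutualInfo_add_compl (P : Finset κ) :
    mutualInfo Ψ {none} (P.map Function.Embedding.some) +
      mutualInfo Ψ {none} (Pᶜ.map Function.Embedding.some) = 2 * entropy Ψ {none} := by
  rw [mutualInfo_eq, mutualInfo_eq, compl_compl]
  ring

/-- The information of `P` on the reference is controlled by the purity of the probes on `P`. -/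
theorem mutualInfo_le (hΨ : ∑ x, Ψ x * star (Ψ x) = 1) (P : Finset κ) :
    mutualInfo Ψ {none} (P.map Function.Embedding.some) ≤
    3 / Real.log 2 * (2 ^ P.card * meanPurity Ψ P - 1) := by
  have hl := Real.log_pos one_lt_two
  have h1 := le_entropy_map_some_compl hΨ P
  have h2 := entropy_le_card hΨ {none}
  have h3 := entropy_le_card hΨ (P.map Function.Embedding.some)
  rw [Finset.card_map] at h3
  rw [Finset.card_singleton, Nat.cast_one] at h2
  rw [mutualInfo_eq, div_mul_eq_mul_div, le_div_iff₀ hl]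
  nlinarith

end Reference

/-! ### Haar-random unitaries -/

section Haar

variable {m : Type} [Fintype m] [DecidableEq m]

instance instIsProbabilityMeasureHaarUnitary : IsProbabilityMeasure (haarUnitary m) :=
  ⟨Measure.haarMeasure_self⟩

instance instIsMulLeftInvariantHaarUnitary : (haarUnitary m).IsMulLeftInvariant :=
  Measure.isMulLeftInvariant_haarMeasure _

theorem continuous_unitary_mulVec (w : m → ℂ) :
    Continuous fun U : unitaryGroup m ℂ => (U : Matrix m m ℂ) *ᵥ w :=
  continuous_subtype_val.matrix_mulVec continuous_const

/-- The image of a fixed unit vector under a Haar-random unitary is uniform on the sphere. -/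
theorem isUniformUnitVector_mulVec {w : m → ℂ} (hw : ∑ i, w i * star (w i) = 1) :
    IsUniformUnitVector (haarUnitary m) fun U => (U : Matrix m m ℂ) *ᵥ w where
  measurable := (continuous_unitary_mulVec w).measurable
  norm_sq U := (norm_sq_mulVec U.2 w).trans hw
  invariant W hW f _ := by
    have h := integral_mul_left_eq_self (μ := haarUnitary m)
      (fun U => f ((U : Matrix m m ℂ) *ᵥ w)) ⟨W, hW⟩
    simp only [mulVec_mulVec]
    exact h

theorem integrable_haarUnitary {f : unitaryGroup m ℂ → ℝ} (hf : Continuous f) :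
    Integrable f (haarUnitary m) :=
  hf.integrable_of_hasCompactSupport (HasCompactSupport.of_compactSpace f)

end Haar

/-! ### The encoded state -/

section Encoding

theorem sum_bits_option {κ : Type} [Fintype κ] [DecidableEq κ] (f : Bits (Option κ) → ℂ) :
    ∑ x, f x = ∑ r : Fin 2, ∑ s : Bits κ, f fun o => o.elim r s := by
  rw [← Fintype.sum_prod_type', ← (Equiv.piOptionEquivProd (β := fun _ => Fin 2)).symm.sum_comp]
  refine Finset.sum_congr rfl fun p _ => congrArg f ?_
  ext o
  cases o <;> rfl

variable {n : ℕ} {φ : EuclideanSpace ℂ (Bits (Fin n))}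

theorem slice_initialState (r : Fin 2) (y : Bits (Fin (n + 1))) :
    slice (initialState φ) r y =
      if r = y 0 then ((1 / √2 : ℝ) : ℂ) * φ (fun i => y i.succ) else 0 := rfl

/-- The two branches of the initial state are orthogonal and equally likely. -/
theorem slice_initialState_inner (hφ : ‖φ‖ = 1) (r s : Fin 2) :
    ∑ y, slice (initialState φ) r y * star (slice (initialState φ) s y) =
      if r = s then 1 / 2 else 0 := by
  have h1 : ∑ t, φ t * star (φ t) = 1 := by
    have h := EuclideanSpace.norm_sq_eq φ
    rw [hφ, one_pow] at h
    have h' : ((∑ t, ‖φ t‖ ^ 2 : ℝ) : ℂ) = 1 := by rw [← h, Complex.ofReal_one]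
    rw [← h']
    push_cast
    exact Finset.sum_congr rfl fun t _ => Complex.mul_conj' _
  have h2 : ((1 / √2 : ℝ) : ℂ) * star ((1 / √2 : ℝ) : ℂ) = 1 / 2 := by
    rw [Complex.star_def, Complex.conj_ofReal, ← Complex.ofReal_mul, div_mul_div_comm,
      Real.mul_self_sqrt zero_le_two]
    norm_num
  rw [← (Fin.consEquiv fun _ => Fin 2).sum_comp, Fintype.sum_prod_type]
  simp only [slice_initialState, Fin.consEquiv, Equiv.coe_fn_mk, Fin.cons_zero, Fin.cons_succ]
  by_cases hrs : r = s
  · subst hrs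
    rw [Finset.sum_eq_single r]
    · simp only [if_true, star_mul']
      calc _ = ∑ t, ((1 / √2 : ℝ) : ℂ) * star ((1 / √2 : ℝ) : ℂ) * (φ t * star (φ t)) :=
            Finset.sum_congr rfl fun t _ => by ring
        _ = 1 / 2 := by rw [← Finset.mul_sum, h1, h2, mul_one]
    · intro a _ ha
      simp [Ne.symm ha]
    · simp
  · rw [if_neg hrs]
    refine Finset.sum_eq_zero fun a _ => Finset.sum_eq_zero fun t _ => ?_
    by_cases hr : r = a
    · rw [if_neg fun h : s = a => hrs (hr.trans h.symm), star_zero, mul_zero]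
    · simp [hr]

theorem norm_sq_initialState (hφ : ‖φ‖ = 1) :
    ∑ x, initialState φ x * star (initialState φ x) = 1 := by
  rw [sum_bits_option]
  have h := slice_initialState_inner hφ
  simp only [slice] at h
  rw [Fin.sum_univ_two, h, h]
  norm_num

theorem norm_sq_probe (hφ : ‖φ‖ = 1) (j : Fin 6) :
    ∑ y, probe (slice (initialState φ)) j y * star (probe (slice (initialState φ)) j y) = 1 := by
  have h := slice_initialState_inner hφ
  -- Each probe is `a v₀ + b v₁` with `|a|² + |b|² = 2`.
  have e : ∀ a b : ℂ, a * star a + b * star b = 2 →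
      ∑ y, (a • slice (initialState φ) 0 + b • slice (initialState φ) 1) y *
        star ((a • slice (initialState φ) 0 + b • slice (initialState φ) 1) y) = 1 := by
    intro a b hab
    have e1 : ∀ y, (a • slice (initialState φ) 0 + b • slice (initialState φ) 1) y *
        star ((a • slice (initialState φ) 0 + b • slice (initialState φ) 1) y) =
        a * star a * (slice (initialState φ) 0 y * star (slice (initialState φ) 0 y))
        + a * star b * (slice (initialState φ) 0 y * star (slice (initialState φ) 1 y))
        + b * star a * (slice (initialState φ) 1 y * star (slice (initialState φ) 0 y))
        + b * star b * (slice (initialState φ) 1 y * star (slice (initialState φ) 1 y)) := by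
      intro y
      simp only [Pi.add_apply, Pi.smul_apply, smul_eq_mul, star_add, star_mul']
      ring
    simp only [e1, Finset.sum_add_distrib, ← Finset.mul_sum, h]
    simp only [if_true, zero_ne_one, one_ne_zero, if_false]
    linear_combination (1 / 2 : ℂ) * hab
  have hs : ((√2 : ℝ) : ℂ) * star ((√2 : ℝ) : ℂ) = 2 := by
    rw [Complex.star_def, Complex.conj_ofReal, ← Complex.ofReal_mul,
      Real.mul_self_sqrt zero_le_two]
    norm_num
  fin_cases j
  · simpa [probe] using e ((√2 : ℝ) : ℂ) 0 (by simpa using hs)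
  · simpa [probe] using e 0 ((√2 : ℝ) : ℂ) (by simpa using hs)
  · simpa [probe] using e 1 1 (by norm_num)
  · simpa [probe] using e 1 (-1) (by norm_num)
  · simpa [probe] using e 1 Complex.I (by norm_num)
  · simpa [probe] using e 1 (-Complex.I) (by norm_num)

theorem probe_encodedState (U : unitaryGroup (Bits (Fin (n + 1))) ℂ) (j : Fin 6) :
    probe (slice (encodedState φ U)) j =
      (U : Matrix (Bits (Fin (n + 1))) (Bits (Fin (n + 1))) ℂ) *ᵥ
        probe (slice (initialState φ)) j :=
  probe_map (E := Bits (Fin (n + 1)) → ℂ) (F := Bits (Fin (n + 1)) → ℂ)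
    (mulVecLin (U : Matrix (Bits (Fin (n + 1))) (Bits (Fin (n + 1))) ℂ)) (slice (initialState φ)) j

theorem norm_sq_encodedState (hφ : ‖φ‖ = 1) (U : unitaryGroup (Bits (Fin (n + 1))) ℂ) :
    ∑ x, encodedState φ U x * star (encodedState φ U x) = 1 := by
  rw [← norm_sq_initialState hφ, sum_bits_option, sum_bits_option]
  refine Finset.sum_congr rfl fun r _ => ?_
  exact norm_sq_mulVec U.2 (slice (initialState φ) r)

/-- The probes of an encoded state are unit vectors. -/
theorem meanPurity_empty (hφ : ‖φ‖ = 1) (U : unitaryGroup (Bits (Fin (n + 1))) ℂ) :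
    meanPurity (encodedState φ U) ∅ = 1 := by
  have h : ∀ j, matrixPurity (amplitudeMatrix ∅ (probe (slice (encodedState φ U)) j)) = 1 := by
    intro j
    have : IsEmpty {i : Fin (n + 1) // i ∈ (∅ : Finset (Fin (n + 1)))} :=
      ⟨fun i => absurd i.2 (Finset.notMem_empty _)⟩
    have h1 := trace_reducedDensity (probe (slice (encodedState φ U)) j) ∅
    rw [probe_encodedState, norm_sq_mulVec U.2, norm_sq_probe hφ, ← probe_encodedState,
      reducedDensity_eq_mul, trace, Fintype.sum_unique, diag] at h1
    rw [matrixPurity, Fintype.sum_unique, Fintype.sum_unique, h1]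
    simp
  simp [meanPurity, h]

theorem regionInfo_add_compl (hφ : ‖φ‖ = 1) (U : unitaryGroup (Bits (Fin (n + 1))) ℂ)
    (P : Finset (Fin (n + 1))) : regionInfo φ U P + regionInfo φ U Pᶜ = 2 := by
  rw [regionInfo, regionInfo, mutualInfo_add_compl,
    entropy_reference (norm_sq_encodedState hφ U) (meanPurity_empty hφ U), mul_one]

theorem secretInfo_le_two (hφ : ‖φ‖ = 1) : secretInfo φ ≤ 2 := by
  have h1 := entropy_le_card (norm_sq_initialState hφ) {none}
  have h2 := entropy_le_card (norm_sq_initialState hφ) {some 0}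
  have h3 := entropy_nonneg (norm_sq_initialState hφ) ({none} ∪ {some 0})
  simp only [Finset.card_singleton, Nat.cast_one] at h1 h2
  rw [secretInfo, mutualInfo]
  linarith

theorem continuous_encodedState (x : Bits (Option (Fin (n + 1)))) :
    Continuous fun U : unitaryGroup (Bits (Fin (n + 1))) ℂ => encodedState φ U x :=
  continuous_finsetSum _ fun y _ =>
    (Continuous.matrix_elem continuous_subtype_val (fun i => x (some i)) y).mul continuous_const

theorem continuous_regionInfo (hφ : ‖φ‖ = 1) (P : Finset (Fin (n + 1))) :
    Continuous fun U => regionInfo φ U P := by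
  have h : ∀ A, Continuous fun U : unitaryGroup (Bits (Fin (n + 1))) ℂ =>
      entropy (encodedState φ U) A := fun A => by
    refine continuous_vonNeumannEntropy
      (fun U : unitaryGroup (Bits (Fin (n + 1))) ℂ => reducedDensity (encodedState φ U) A) ?_
      (fun U => reducedDensity_posSemidef _ A)
      (fun U => (trace_reducedDensity _ A).trans (norm_sq_encodedState hφ U))
    refine continuous_matrix fun x y => continuous_finsetSum _ fun z _ => ?_
    exact (continuous_encodedState (glue A x z)).mul (continuous_encodedState (glue A y z)).star
  exact ((h _).add (h _)).sub (h _)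

theorem continuous_purity_probe (P : Finset (Fin (n + 1))) (j : Fin 6) : Continuous fun U =>
    matrixPurity (amplitudeMatrix P (probe (slice (encodedState φ U)) j)) := by
  refine continuous_matrixPurity.comp (continuous_matrix fun x z => ?_)
  simp only [amplitudeMatrix, of_apply, probe_encodedState]
  exact (continuous_apply (glue P x z)).comp
    (continuous_unitary_mulVec (probe (slice (initialState φ)) j))

theorem continuous_meanPurity (P : Finset (Fin (n + 1))) :
    Continuous fun U => meanPurity (encodedState φ U) P :=
  continuous_const.mul (continuous_finsetSum _ fun j _ => continuous_purity_probe P j)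

/-- The mean of the purity on `P` of a random pure state of `n + 1` qubits. -/
def expectedPurity (P : Finset (Fin (n + 1))) : ℝ :=
  (2 ^ P.card + 2 ^ Pᶜ.card) / (2 ^ (n + 1) + 1)

theorem two_pow_card_mul_compl (P : Finset (Fin (n + 1))) :
    (2 : ℝ) ^ P.card * 2 ^ Pᶜ.card = 2 ^ (n + 1) := by
  rw [← pow_add, Finset.card_add_card_compl, Fintype.card_fin]

theorem isUniformUnitVector_probe (hφ : ‖φ‖ = 1) (P : Finset (Fin (n + 1))) (j : Fin 6) :
    IsUniformUnitVector (haarUnitary (Bits (Fin (n + 1)))) fun U i =>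
      probe (slice (encodedState φ U)) j (glueEquiv P i) := by
  simp only [probe_encodedState]
  exact (isUniformUnitVector_mulVec (norm_sq_probe hφ j)).reindex (glueEquiv P)

theorem integral_purity_probe (hφ : ‖φ‖ = 1) (P : Finset (Fin (n + 1))) (j : Fin 6) :
    ∫ U, matrixPurity (amplitudeMatrix P (probe (slice (encodedState φ U)) j))
      ∂(haarUnitary (Bits (Fin (n + 1)))) = expectedPurity P := by
  have h := (isUniformUnitVector_probe hφ P j).integral_purity
  rw [card_bits, card_bits_not_mem] at h
  push_cast at h
  rw [two_pow_card_mul_compl] at h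
  exact h

theorem integral_purity_probe_sub_sq_le (hφ : ‖φ‖ = 1) (P : Finset (Fin (n + 1))) (j : Fin 6) :
    ∫ U, (matrixPurity (amplitudeMatrix P (probe (slice (encodedState φ U)) j)) -
        expectedPurity P) ^ 2 ∂(haarUnitary (Bits (Fin (n + 1)))) ≤ 2 / 4 ^ (n + 1) := by
  have h := (isUniformUnitVector_probe hφ P j).integral_purity_sub_sq_le
  rw [card_bits, card_bits_not_mem] at h
  push_cast at h
  rw [two_pow_card_mul_compl, ← pow_mul, mul_comm (n + 1) 2, pow_mul] at h
  norm_num at h ⊢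
  exact h

theorem integral_meanPurity (hφ : ‖φ‖ = 1) (P : Finset (Fin (n + 1))) :
    ∫ U, meanPurity (encodedState φ U) P ∂(haarUnitary (Bits (Fin (n + 1)))) =
      expectedPurity P := by
  simp only [meanPurity]
  rw [integral_const_mul, integral_finsetSum _ fun j _ =>
    integrable_haarUnitary (continuous_purity_probe P j)]
  simp only [integral_purity_probe hφ]
  simp

theorem integral_meanPurity_sub_sq_le (hφ : ‖φ‖ = 1) (P : Finset (Fin (n + 1))) :
    ∫ U, (meanPurity (encodedState φ U) P - expectedPurity P) ^ 2
      ∂(haarUnitary (Bits (Fin (n + 1)))) ≤ 2 / 4 ^ (n + 1) := by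
  have hc : ∀ j, Integrable (fun U =>
      (matrixPurity (amplitudeMatrix P (probe (slice (encodedState φ U)) j)) -
        expectedPurity P) ^ 2) (haarUnitary (Bits (Fin (n + 1)))) := fun j =>
    integrable_haarUnitary (((continuous_purity_probe P j).sub continuous_const).pow 2)
  calc _ ≤ ∫ U, 1 / 6 * ∑ j, (matrixPurity (amplitudeMatrix P
          (probe (slice (encodedState φ U)) j)) - expectedPurity P) ^ 2
          ∂(haarUnitary (Bits (Fin (n + 1)))) := by
        refine integral_mono (integrable_haarUnitary
          (((continuous_meanPurity P).sub continuous_const).pow 2))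
          ((integrable_finsetSum _ fun j _ => hc j).const_mul _) fun U => ?_
        have h := sq_sum_le_card_mul_sum_sq (s := Finset.univ) (f := fun j : Fin 6 =>
          matrixPurity (amplitudeMatrix P (probe (slice (encodedState φ U)) j)) - expectedPurity P)
        rw [Finset.sum_sub_distrib] at h
        simp only [Finset.sum_const, Finset.card_univ, Fintype.card_fin, nsmul_eq_mul] at h
        simp only [meanPurity]
        push_cast at h
        linarith
    _ = 1 / 6 * ∑ j : Fin 6, ∫ U, (matrixPurity (amplitudeMatrix P
          (probe (slice (encodedState φ U)) j)) - expectedPurity P) ^ 2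
          ∂(haarUnitary (Bits (Fin (n + 1)))) := by
        rw [integral_const_mul, integral_finsetSum _ fun j _ => hc j]
    _ ≤ 1 / 6 * ∑ j : Fin 6, 2 / 4 ^ (n + 1) := by
        gcongr with j
        exact integral_purity_probe_sub_sq_le hφ P j
    _ = 2 / 4 ^ (n + 1) := by simp

/-- On a region of `p` qubits, `2 ^ p` times the expected purity exceeds its minimum `1` by at most
the ratio of the dimensions of the region and of its complement. -/
theorem two_pow_mul_expectedPurity_le (P : Finset (Fin (n + 1))) {ε : ℝ}
    (hP : (P.card : ℝ) ≤ ((n : ℝ) + 1) / 2 - ε) :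
    2 ^ P.card * expectedPurity P ≤ 1 + (4 : ℝ) ^ (-ε) := by
  have h0 := two_pow_card_mul_compl P
  have h1 : (2 : ℝ) ^ P.card * 2 ^ P.card ≤ (4 : ℝ) ^ (-ε) * 2 ^ (n + 1) := by
    have e1 : (2 : ℝ) ^ P.card * 2 ^ P.card = (4 : ℝ) ^ (P.card : ℝ) := by
      rw [← mul_pow, Real.rpow_natCast]; norm_num
    have e2 : (2 : ℝ) ^ (n + 1) = (4 : ℝ) ^ (((n : ℝ) + 1) / 2) := by
      rw [show (4 : ℝ) = 2 ^ (2 : ℝ) by norm_num, ← Real.rpow_mul zero_le_two,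
        ← Real.rpow_natCast]
      push_cast
      ring_nf
    rw [e1, e2, ← Real.rpow_add (by norm_num)]
    exact Real.rpow_le_rpow_of_exponent_le (by norm_num) (by linarith)
  have h2 : (0 : ℝ) < 4 ^ (-ε) := by positivity
  rw [expectedPurity, mul_div_assoc', div_le_iff₀ (by positivity), mul_add, h0]
  nlinarith

end Encoding

/-! ### Counting regions -/

section Counting

/-- The bound `4 ^ r / √(2 r + 1)` for the central binomial coefficient, in integers. -/
theorem centralBinom_sq_mul_le (r : ℕ) : r.centralBinom ^ 2 * (2 * r + 1) ≤ 16 ^ r := by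
  induction r with
  | zero => simp
  | succ r ih =>
    have h := Nat.succ_mul_centralBinom_succ r
    have h1 : (r + 1) ^ 2 * ((r + 1).centralBinom ^ 2 * (2 * (r + 1) + 1)) ≤
        (r + 1) ^ 2 * 16 ^ (r + 1) :=
      calc (r + 1) ^ 2 * ((r + 1).centralBinom ^ 2 * (2 * (r + 1) + 1))
          = ((r + 1) * (r + 1).centralBinom) ^ 2 * (2 * r + 3) := by ring
        _ = (r.centralBinom ^ 2 * (2 * r + 1)) * (4 * ((2 * r + 1) * (2 * r + 3))) := by
            rw [h]; ring
        _ ≤ 16 ^ r * (4 * (4 * (r + 1) ^ 2)) :=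
            Nat.mul_le_mul ih (Nat.mul_le_mul_left _ (by nlinarith))
        _ = (r + 1) ^ 2 * 16 ^ (r + 1) := by ring
    exact Nat.le_of_mul_le_mul_left h1 (by positivity)

theorem choose_succ_le_two_mul_middle (n k : ℕ) : (n + 1).choose k ≤ 2 * n.choose (n / 2) := by
  cases k with
  | zero =>
    have := Nat.choose_pos (Nat.div_le_self n 2)
    rw [Nat.choose_zero_right]
    omega
  | succ k =>
    rw [Nat.choose_succ_succ']
    have h1 := Nat.choose_le_middle k n
    have h2 := Nat.choose_le_middle (k + 1) n
    omega

theorem choose_middle_sq_mul_le (n : ℕ) : n.choose (n / 2) ^ 2 * n ≤ 4 ^ n := by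
  have e : ∀ r : ℕ, (4 : ℕ) ^ (2 * r) = 16 ^ r := fun r => by rw [pow_mul]; norm_num
  obtain ⟨r, rfl | rfl⟩ := Nat.even_or_odd' n
  · have h := centralBinom_sq_mul_le r
    rw [Nat.centralBinom] at h
    rw [e, Nat.mul_div_cancel_left r two_pos]
    exact (Nat.mul_le_mul_left _ (Nat.le_succ _)).trans h
  · have h1 := choose_succ_le_two_mul_middle (2 * r) ((2 * r + 1) / 2)
    have h := centralBinom_sq_mul_le r
    rw [Nat.mul_div_cancel_left r two_pos] at h1
    rw [Nat.centralBinom] at h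
    rw [pow_succ 4, e]
    calc _ ≤ (2 * (2 * r).choose r) ^ 2 * (2 * r + 1) := by gcongr
      _ = ((2 * r).choose r ^ 2 * (2 * r + 1)) * 4 := by ring
      _ ≤ 16 ^ r * 4 := by gcongr

theorem three_mul_sum_four_pow_le (N : ℕ) :
    3 * ∑ P : Finset (Fin N) with P.card ≤ N / 2, 4 ^ P.card ≤ 4 * 2 ^ N * N.choose (N / 2) := by
  rw [Finset.sum_filter]
  have h := Finset.sum_powerset_apply_card (fun k => if k ≤ N / 2 then 4 ^ k else 0)
    (x := (Finset.univ : Finset (Fin N)))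
  rw [Finset.powerset_univ] at h
  rw [h, Finset.card_univ, Fintype.card_fin]
  have h1 : ∑ k ∈ Finset.range (N + 1), N.choose k • (if k ≤ N / 2 then 4 ^ k else 0) ≤
      ∑ k ∈ Finset.range (N / 2 + 1), N.choose (N / 2) * 4 ^ k := by
    rw [← Finset.sum_filter_add_sum_filter_not _ (· ≤ N / 2)]
    have h2 : ∑ k ∈ Finset.range (N + 1) with ¬k ≤ N / 2,
        N.choose k • (if k ≤ N / 2 then 4 ^ k else 0) = 0 :=
      Finset.sum_eq_zero fun k hk => by rw [if_neg (Finset.mem_filter.1 hk).2, smul_zero]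
    rw [h2, add_zero]
    have h3 : (Finset.range (N + 1)).filter (· ≤ N / 2) = Finset.range (N / 2 + 1) := by
      ext k
      simp only [Finset.mem_filter, Finset.mem_range]
      omega
    rw [h3]
    refine Finset.sum_le_sum fun k hk => ?_
    rw [if_pos (Nat.lt_succ_iff.1 (Finset.mem_range.1 hk)), smul_eq_mul]
    exact Nat.mul_le_mul_right _ (Nat.choose_le_middle k N)
  rw [← Finset.mul_sum] at h1
  have h4 : 3 * ∑ k ∈ Finset.range (N / 2 + 1), 4 ^ k ≤ 4 * 2 ^ N := by
    have h5 := Nat.geomSum_eq (m := 4) (by norm_num) (N / 2 + 1)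
    have h6 : (4 : ℕ) ^ (N / 2 + 1) ≤ 4 * 2 ^ N := by
      rw [pow_succ, mul_comm]
      refine Nat.mul_le_mul_left _ ?_
      calc (4 : ℕ) ^ (N / 2) = 2 ^ (2 * (N / 2)) := by rw [pow_mul]; norm_num
        _ ≤ 2 ^ N := Nat.pow_le_pow_right two_pos (Nat.mul_div_le N 2)
    rw [h5]
    omega
  calc _ ≤ 3 * (N.choose (N / 2) * ∑ k ∈ Finset.range (N / 2 + 1), 4 ^ k) := by gcongr
    _ = N.choose (N / 2) * (3 * ∑ k ∈ Finset.range (N / 2 + 1), 4 ^ k) := by ring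
    _ ≤ N.choose (N / 2) * (4 * 2 ^ N) := by gcongr
    _ = _ := by ring

/-- There are only `O(2 ^ N / √N)` regions of half the size, and the weight `4 ^ P.card` makes the
sum geometric in the size: this factor `√N` is what makes the union bound over all regions
converge. -/
theorem sum_four_pow_div_le {N : ℕ} {K δ : ℝ} (hK : 0 ≤ K) (hδ : 0 < δ)
    (hN : (2 * K / δ) ^ 2 ≤ N) :
    ∑ P : Finset (Fin N) with P.card ≤ N / 2, (4 : ℝ) ^ P.card * (K / 4 ^ N) ≤ δ := by
  have h1 : (3 : ℝ) * ∑ P : Finset (Fin N) with P.card ≤ N / 2, (4 : ℝ) ^ P.card ≤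
      4 * 2 ^ N * N.choose (N / 2) := by
    exact_mod_cast three_mul_sum_four_pow_le N
  have h2 : ((N.choose (N / 2) : ℝ)) ^ 2 * N ≤ 4 ^ N := by
    exact_mod_cast choose_middle_sq_mul_le N
  have h4 : (4 : ℝ) ^ N = 2 ^ N * 2 ^ N := by rw [← mul_pow]; norm_num
  have h3 : 2 * K * N.choose (N / 2) ≤ δ * 2 ^ N := by
    refine le_of_sq_le_sq ?_ (by positivity)
    rw [div_pow, div_le_iff₀ (by positivity)] at hN
    calc (2 * K * (N.choose (N / 2) : ℝ)) ^ 2 = (2 * K) ^ 2 * (N.choose (N / 2) : ℝ) ^ 2 := by ring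
      _ ≤ N * δ ^ 2 * (N.choose (N / 2) : ℝ) ^ 2 := by gcongr
      _ = δ ^ 2 * ((N.choose (N / 2) : ℝ) ^ 2 * N) := by ring
      _ ≤ δ ^ 2 * 4 ^ N := by gcongr
      _ = (δ * 2 ^ N) ^ 2 := by rw [h4]; ring
  rw [← Finset.sum_mul, mul_div_assoc', div_le_iff₀ (by positivity)]
  have h5 : (0 : ℝ) < 2 ^ N := by positivity
  have h6 := mul_le_mul_of_nonneg_left h1 hK
  have h7 := mul_le_mul_of_nonneg_right h3 h5.le
  have h8 : 0 ≤ δ * 2 ^ N * 2 ^ N := by positivity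
  rw [h4]
  nlinarith

end Counting

/-! ### Secrecy and recoverability -/

section Main

variable {n : ℕ} {φ : EuclideanSpace ℂ (Bits (Fin n))}

theorem regionInfo_le (hφ : ‖φ‖ = 1) (U : Matrix.unitaryGroup (Bits (Fin (n + 1))) ℂ)
    (P : Finset (Fin (n + 1))) : regionInfo φ U P ≤
      3 / Real.log 2 * (2 ^ P.card * meanPurity (encodedState φ U) P - 1) :=
  mutualInfo_le (norm_sq_encodedState hφ U) P

theorem card_compl_le_of_le_card {P : Finset (Fin (n + 1))} {ε : ℝ}
    (hP : ((n : ℝ) + 1) / 2 + ε ≤ (P.card : ℝ)) : (Pᶜ.card : ℝ) ≤ ((n : ℝ) + 1) / 2 - ε := by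
  have h : (P.card : ℝ) + Pᶜ.card = n + 1 := by
    exact_mod_cast (Finset.card_add_card_compl P).trans (Fintype.card_fin _)
  linarith

theorem integrable_regionInfo (hφ : ‖φ‖ = 1) (P : Finset (Fin (n + 1))) :
    Integrable (fun U => regionInfo φ U P) (haarUnitary (Bits (Fin (n + 1)))) :=
  integrable_haarUnitary (continuous_regionInfo hφ P)

theorem integral_regionInfo_le (hφ : ‖φ‖ = 1) {P : Finset (Fin (n + 1))} {ε : ℝ}
    (hP : (P.card : ℝ) ≤ ((n : ℝ) + 1) / 2 - ε) :
    ∫ U, regionInfo φ U P ∂(haarUnitary (Bits (Fin (n + 1)))) ≤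
      3 / Real.log 2 * (4 : ℝ) ^ (-ε) := by
  have hi := integrable_haarUnitary (continuous_meanPurity (φ := φ) P)
  have h := integral_mono (integrable_regionInfo hφ P)
    (((hi.const_mul (2 ^ P.card)).sub (integrable_const 1)).const_mul (3 / Real.log 2))
    fun U => regionInfo_le hφ U P
  refine h.trans ?_
  simp only [Pi.sub_apply]
  rw [integral_const_mul, integral_sub (hi.const_mul _) (integrable_const _), integral_const_mul,
    integral_meanPurity hφ]
  have hl := Real.log_pos one_lt_two
  have h1 := two_pow_mul_expectedPurity_le P hP
  simp only [integral_const, probReal_univ, smul_eq_mul, mul_one]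
  gcongr
  linarith

/-- Recoverability from `P` is secrecy of `Pᶜ`. -/
theorem le_integral_regionInfo (hφ : ‖φ‖ = 1) {P : Finset (Fin (n + 1))} {ε : ℝ}
    (hP : ((n : ℝ) + 1) / 2 + ε ≤ (P.card : ℝ)) :
    secretInfo φ - 3 / Real.log 2 * (4 : ℝ) ^ (-ε) ≤
      ∫ U, regionInfo φ U P ∂(haarUnitary (Bits (Fin (n + 1)))) := by
  have h := integral_regionInfo_le hφ (card_compl_le_of_le_card hP)
  have h1 : ∀ U, regionInfo φ U P = 2 - regionInfo φ U Pᶜ := fun U =>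
    eq_sub_of_add_eq (regionInfo_add_compl hφ U P)
  simp only [h1]
  rw [integral_sub (integrable_const _) (integrable_regionInfo hφ Pᶜ)]
  have h2 := secretInfo_le_two hφ
  simp only [integral_const, probReal_univ, smul_eq_mul, one_mul]
  linarith

/-- Chebyshev's inequality for the mean purity of the probes. -/
theorem measureReal_meanPurity_le (hφ : ‖φ‖ = 1) (P : Finset (Fin (n + 1))) {t : ℝ} (ht : 0 < t) :
    (haarUnitary (Bits (Fin (n + 1)))).real
        {U | expectedPurity P + t / 2 ^ P.card ≤ meanPurity (encodedState φ U) P} ≤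
      4 ^ P.card * (2 / t ^ 2 / 4 ^ (n + 1)) := by
  have hs : (0 : ℝ) < t / 2 ^ P.card := by positivity
  have h1 := mul_meas_ge_le_integral_of_nonneg (μ := haarUnitary (Bits (Fin (n + 1))))
    (f := fun U => (meanPurity (encodedState φ U) P - expectedPurity P) ^ 2)
    (Filter.Eventually.of_forall fun U => sq_nonneg _)
    (integrable_haarUnitary (((continuous_meanPurity P).sub continuous_const).pow 2))
    ((t / 2 ^ P.card) ^ 2)
  have h2 := h1.trans (integral_meanPurity_sub_sq_le hφ P)
  have h3 : (haarUnitary (Bits (Fin (n + 1)))).real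
      {U | expectedPurity P + t / 2 ^ P.card ≤ meanPurity (encodedState φ U) P} ≤
      (haarUnitary (Bits (Fin (n + 1)))).real {U | (t / 2 ^ P.card) ^ 2 ≤
        (meanPurity (encodedState φ U) P - expectedPurity P) ^ 2} := by
    refine measureReal_mono fun U hU => ?_
    have hU' : expectedPurity P + t / 2 ^ P.card ≤ meanPurity (encodedState φ U) P := hU
    exact pow_le_pow_left₀ hs.le (by linarith) 2
  refine h3.trans ?_
  rw [← le_div_iff₀' (by positivity)] at h2
  refine h2.trans_eq ?_
  have h4 : (4 : ℝ) ^ P.card = (2 ^ P.card) ^ 2 := by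
    rw [← pow_mul, mul_comm, pow_mul]; norm_num
  rw [h4]
  field_simp

/-- Outside the union over all small regions of the Chebyshev events the encoding is a ramp
scheme. -/
theorem isApproxRampScheme_of_forall_lt (hφ : ‖φ‖ = 1) {ε : ℝ} (hε : 0 < ε)
    (hn : 2 * ε + 2 ≤ (n : ℝ) + 1) (U : Matrix.unitaryGroup (Bits (Fin (n + 1))) ℂ)
    (h : ∀ P : Finset (Fin (n + 1)), (P.card : ℝ) ≤ ((n : ℝ) + 1) / 2 - ε →
      meanPurity (encodedState φ U) P < expectedPurity P + (4 : ℝ) ^ (-ε) / 2 ^ P.card) :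
    IsApproxRampScheme φ U (((n : ℝ) + 1) / 2 - ε) (((n : ℝ) + 1) / 2 + ε)
      (6 / Real.log 2 * (4 : ℝ) ^ (-ε)) := by
  -- The mean and the deviation of `2 ^ |P|` times the purity contribute `4 ^ (-ε)` each.
  have hsec : ∀ P : Finset (Fin (n + 1)), (P.card : ℝ) ≤ ((n : ℝ) + 1) / 2 - ε →
      regionInfo φ U P ≤ 6 / Real.log 2 * (4 : ℝ) ^ (-ε) := fun P hP => by
    have hl := Real.log_pos one_lt_two
    have hp : (0 : ℝ) < 2 ^ P.card := by positivity
    have h1 := mul_lt_mul_of_pos_left (h P hP) hp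
    rw [mul_add, mul_div_cancel₀ _ hp.ne'] at h1
    have h2 := two_pow_mul_expectedPurity_le P hP
    calc regionInfo φ U P
        ≤ 3 / Real.log 2 * (2 ^ P.card * meanPurity (encodedState φ U) P - 1) :=
          regionInfo_le hφ U P
      _ ≤ 3 / Real.log 2 * (2 * (4 : ℝ) ^ (-ε)) := by gcongr; linarith
      _ = _ := by ring
  refine ⟨by linarith, by linarith, by linarith, hsec, fun P hP => ?_⟩
  have h1 := hsec Pᶜ (card_compl_le_of_le_card hP)
  have h2 := regionInfo_add_compl hφ U P
  have h3 := secretInfo_le_two hφ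
  linarith

theorem measure_not_isApproxRampScheme_le {ε δ : ℝ} (hε : 0 < ε) (hδ : 0 < δ)
    (hn : 2 * ε + 2 ≤ (n : ℝ) + 1)
    (hn' : (2 * (2 / ((4 : ℝ) ^ (-ε)) ^ 2) / δ) ^ 2 ≤ (n : ℝ) + 1) (hφ : ‖φ‖ = 1) :
    haarUnitary (Bits (Fin (n + 1)))
      {U | ¬ IsApproxRampScheme φ U (((n : ℝ) + 1) / 2 - ε) (((n : ℝ) + 1) / 2 + ε)
        (6 / Real.log 2 * (4 : ℝ) ^ (-ε))} ≤ ENNReal.ofReal δ := by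
  have hγ : (0 : ℝ) < 4 ^ (-ε) := by positivity
  set S : Finset (Finset (Fin (n + 1))) :=
    Finset.univ.filter fun P => P.card ≤ (n + 1) / 2 with hS
  set B : Finset (Fin (n + 1)) → Set (Matrix.unitaryGroup (Bits (Fin (n + 1))) ℂ) := fun P =>
    {U | expectedPurity P + (4 : ℝ) ^ (-ε) / 2 ^ P.card ≤ meanPurity (encodedState φ U) P} with hB
  have hsub : {U | ¬ IsApproxRampScheme φ U (((n : ℝ) + 1) / 2 - ε) (((n : ℝ) + 1) / 2 + ε)
      (6 / Real.log 2 * (4 : ℝ) ^ (-ε))} ⊆ ⋃ P ∈ S, B P := by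
    intro U hU
    by_contra hcon
    simp only [Set.mem_iUnion, not_exists] at hcon
    refine hU (isApproxRampScheme_of_forall_lt hφ hε hn U fun P hP => ?_)
    have hPS : P ∈ S := by
      rw [hS, Finset.mem_filter]
      refine ⟨Finset.mem_univ P, ?_⟩
      rw [Nat.le_div_iff_mul_le two_pos]
      have : (P.card : ℝ) * 2 ≤ n + 1 := by linarith
      exact_mod_cast this
    exact not_le.1 (hcon P hPS)
  refine (measure_mono hsub).trans ?_
  rw [← ofReal_measureReal (measure_ne_top _ _)]
  refine ENNReal.ofReal_le_ofReal ((measureReal_biUnion_finset_le S B).trans ?_)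
  refine (Finset.sum_le_sum fun P _ => measureReal_meanPurity_le hφ P hγ).trans ?_
  exact sum_four_pow_div_le (N := n + 1) (by positivity) hδ (by push_cast; exact hn')

end Main

end RampSecret

end

open RampSecret in
theorem theorem1 :
    ∃ C : ℝ, 0 < C ∧ ∀ ε : ℝ, 0 < ε →
      -- Haar average, for every number of qubits and every region
      (∀ (n : ℕ) (φ : EuclideanSpace ℂ (Bits (Fin n))), ‖φ‖ = 1 →
        ∀ P : Finset (Fin (n + 1)),
          MeasureTheory.Integrable (fun U => regionInfo φ U P)
            (haarUnitary (Bits (Fin (n + 1)))) ∧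
          ((P.card : ℝ) ≤ ((n : ℝ) + 1) / 2 - ε →
            ∫ U, regionInfo φ U P ∂(haarUnitary (Bits (Fin (n + 1)))) ≤ C * (4 : ℝ) ^ (-ε)) ∧
          (((n : ℝ) + 1) / 2 + ε ≤ (P.card : ℝ) →
            secretInfo φ - C * (4 : ℝ) ^ (-ε) ≤
              ∫ U, regionInfo φ U P ∂(haarUnitary (Bits (Fin (n + 1)))))) ∧
      -- all regions simultaneously, with probability tending to one
      (∀ δ : ℝ, 0 < δ → ∃ n₀ : ℕ, ∀ n : ℕ, n₀ ≤ n →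
        ∀ φ : EuclideanSpace ℂ (Bits (Fin n)), ‖φ‖ = 1 →
          haarUnitary (Bits (Fin (n + 1)))
            {U | ¬ IsApproxRampScheme φ U (((n : ℝ) + 1) / 2 - ε) (((n : ℝ) + 1) / 2 + ε)
              (C * (4 : ℝ) ^ (-ε))} ≤ ENNReal.ofReal δ) := by
  have hl := Real.log_pos one_lt_two
  refine ⟨6 / Real.log 2, by positivity, fun ε hε => ⟨fun n φ hφ P => ?_, fun δ hδ => ?_⟩⟩
  · have h : 3 / Real.log 2 * (4 : ℝ) ^ (-ε) ≤ 6 / Real.log 2 * (4 : ℝ) ^ (-ε) := by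
      gcongr
      norm_num
    exact ⟨integrable_regionInfo hφ P, fun hP => (integral_regionInfo_le hφ hP).trans h,
      fun hP => (sub_le_sub_left h _).trans (le_integral_regionInfo hφ hP)⟩
  · refine ⟨⌈max (2 * ε + 2) ((2 * (2 / ((4 : ℝ) ^ (-ε)) ^ 2) / δ) ^ 2)⌉₊, fun n hn φ hφ => ?_⟩
    have hn1 := Nat.ceil_le.1 hn
    exact measure_not_isApproxRampScheme_le hε hδ
      (by linarith [le_max_left (2 * ε + 2) ((2 * (2 / ((4 : ℝ) ^ (-ε)) ^ 2) / δ) ^ 2)])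
      (by linarith [le_max_right (2 * ε + 2) ((2 * (2 / ((4 : ℝ) ^ (-ε)) ^ 2) / δ) ^ 2)]) hφ
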